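/- Let $0<\alpha<1$. Let $h:[0,1]\to[0,\infty)$ be nondecreasing with $h(0)=0$, $x\le h(x)$ for $0\le x<1$, and $$\int_0^1 \frac{h(x)}{x^{2-\alpha}}\,\ln^2\frac{e}{x}\,dx<\infty .$$ For a subset $A$ of the unit circle put $M_h(A)=\inf\sum_{k} h(|S_k|)$, where the infimum is over all sequences of arcs $S_k$ of the circle, of lengths $|S_k|\le 1$, with $A\subseteq\bigcup_k S_k$. Let $f:[-\pi,\pi]\to\mathbb C$ be a measurable function with $$\int_{-\pi}^{\pi}|f(x)|^2dx+\int_{-\pi}^{\pi}\int_{-\pi}^{\pi}\frac{|f(x)-f(y)|^2}{|x-y|^{1+\alpha}}\,dx\,dy<\infty ,$$ and let $\hat f_k=\frac1{2\pi}\int_{-\pi}^{\pi}f(x)e^{-ikx}dx$ for $k\in\mathbb Z$. Let $E\subset[-\pi,\pi]$ be an arbitrary set such that 1. $M_h(\{e^{ix}:x\in E\})>0$; 2. for every $x\in E$, every prime $p$, every $n\in\mathbb N$ and every $k\in\mathbb Z$, the point $x+\frac{2\pi k}{p^n}$ is congruent modulo $2\pi$ to a point of $E$. If for every $x\in E$ $$\lim_{r\to1-0}\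 \sum_{k=-\infty}^{\infty}r^{|k|}\hat f_k e^{ikx}=0 ,$$ then $f(x)=0$ for almost every $x\in[-\pi,\pi]$. -/

import Mathlib

open Real Set Filter Topology MeasureTheory
open scoped ENNReal

noncomputable section

/-- The closed arc of the unit circle that starts at `exp (i a)` and has length `l`,
traversed counterclockwise. -/
def circleArc (a l : ℝ) : Set Circle :=
  Circle.exp '' Icc a (a + l)

/-- The Hausdorff `h`-measure `M_h(A)` of a subset `A` of the unit circle: the infimum of
`∑ h(|S_k|)` over all covers of `A` by a sequence of arcs `S_k`.  The gauge `h` is a function on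
`[0, 1]`, so the arcs have length at most `1`.  Every arc lies in the closed arc of the same
length, so it does not matter that only closed arcs are used. -/
def hausdorffContent (h : ℝ → ℝ) (A : Set Circle) : ℝ≥0∞ :=
  ⨅ (a : ℕ → ℝ) (l : ℕ → ℝ) (_ : ∀ k, l k ∈ Icc (0 : ℝ) 1)
    (_ : A ⊆ ⋃ k, circleArc (a k) (l k)), ∑' k, ENNReal.ofReal (h (l k))

/-- The energy `∫ |f|² + ∬ |f(x) - f(y)|² / |x - y|^(1+α)` over `[-π, π]`, with values in
`[0, ∞]`. -/
def fractionalEnergy (α : ℝ) (f : ℝ → ℂ) : ℝ≥0∞ :=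
  (∫⁻ x in Icc (-π) π, ‖f x‖ₑ ^ 2) +
    ∫⁻ x in Icc (-π) π, ∫⁻ y in Icc (-π) π,
      ‖f x - f y‖ₑ ^ 2 / ENNReal.ofReal (|x - y| ^ (1 + α))

/-- The `k`-th Fourier coefficient `(1/2π) ∫_{-π}^{π} f(x) e^{-ikx} dx`. -/
def fourierCoefficient (f : ℝ → ℂ) (k : ℤ) : ℂ :=
  fourierCoeffOn (neg_lt_self pi_pos) f k

theorem fourierCoefficient_eq (f : ℝ → ℂ) (k : ℤ) :
    fourierCoefficient f k =
      1 / (2 * π) * ∫ x in (-π)..π, f x * Complex.exp (-(Complex.I * k * x)) := by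
  rw [fourierCoefficient, fourierCoeffOn_eq_integral, Complex.real_smul]
  congr 1
  · push_cast; ring
  · refine intervalIntegral.integral_congr fun x _ => ?_
    simp only [fourier_coe_apply, smul_eq_mul]
    rw [mul_comm]
    congr 2
    have : (π : ℂ) ≠ 0 := by exact_mod_cast pi_ne_zero
    push_cast
    field_simp
    ring

/-- The Abel mean `∑_k r^|k| f̂_k e^{ikx}` of the Fourier series of `f` at the point `x`. -/
def abelMean (f : ℝ → ℂ) (r x : ℝ) : ℂ :=
  ∑' k : ℤ, (r : ℂ) ^ k.natAbs * fourierCoefficient f k * Complex.exp (Complex.I * k * x)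

end

/-! Divide the circle into `2 ^ n` cells of length `s_n = 2π / 2 ^ n`. Call a cell of level `n` bad
if the quadratic oscillation of `f` near it exceeds `(s_n a_n)²`, where `a` is a suitable summable
sequence. Two facts about bad cells carry the proof.

They are cheap. The double integral bounds the oscillation summed over scales
(`tsum_localOscillation_le`), and the squared logarithm in the gauge condition makes `∑ n² s_n^(α-1)
h(8/2^n)` converge (`summable_gauge`). These two series leave room for thresholds `a_n`
(`exists_summable_threshold`) for which the bad cells of level `n` have total `h`-cost at most `3
a_n` (`card_mul_gauge_le`). With `T_N` the tail `∑_{n ≥ N} a_n`, all bad cells from level `N` on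
cost at most `3 T_N`.

Points that avoid them are harmless. If `x` lies in no bad cell of level at least `N`, the
approximating constants of `f` around `x` form a Cauchy sequence, so `x` is a Lebesgue point. By
Fatou's theorem its Lebesgue value is the Abel limit. For `x ∈ E` that limit is `0`, so the integral
of `|f|` over the ball of radius `s_N` about `x` is at most `8 s_N T_N`
(`lintegral_cell_le_of_good`).

Suppose an interior cell of level `N` has no such point of `E`. Its bad subcells then cover the part
of `E` in it, and by invariance their `2 ^ N` rotated copies cover all of `E`. Each such cell
therefore uses up cost at least `M_h(E) / 2 ^ N`, so these cells have total length `O(T_N)`. Hence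
the integral of `min |f| 1` is `O(T_N + s_N)`, which tends to `0`. Only covers of `E` are used, so
`E` need not be measurable. -/

/-! ### The Poisson kernel and Abel means -/

/-- The Poisson kernel of the unit disc as a function of the angle. -/
noncomputable def angularPoisson (r t : ℝ) : ℝ :=
  (1 - r ^ 2) / (1 - 2 * r * Real.cos t + r ^ 2)

theorem angularPoisson_denom_pos {r : ℝ} (h1 : r < 1) (h0 : 0 ≤ r) (t : ℝ) :
    0 < 1 - 2 * r * Real.cos t + r ^ 2 := by
  nlinarith [Real.cos_le_one t, mul_nonneg h0 (sub_nonneg.2 (Real.cos_le_one t)),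
    pow_pos (sub_pos.2 h1) 2]

theorem hasSum_angularPoisson {r : ℝ} (h0 : 0 ≤ r) (h1 : r < 1) (t : ℝ) :
    HasSum (fun k : ℤ => (r : ℂ) ^ k.natAbs * Complex.exp (Complex.I * k * t))
      (angularPoisson r t : ℂ) := by
  set z : ℂ := r * Complex.exp (Complex.I * t) with hz
  set w : ℂ := r * Complex.exp (-(Complex.I * t)) with hw
  have nz : ‖z‖ < 1 := by
    rw [hz, norm_mul, mul_comm Complex.I, Complex.norm_exp_ofReal_mul_I]
    simpa [abs_of_nonneg h0] using h1
  have nw : ‖w‖ < 1 := by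
    rw [hw, norm_mul, mul_comm Complex.I, ← neg_mul, ← Complex.ofReal_neg,
      Complex.norm_exp_ofReal_mul_I]
    simpa [abs_of_nonneg h0] using h1
  have hzw : z * w = r ^ 2 := by
    rw [hz, hw, mul_mul_mul_comm, ← Complex.exp_add]
    simp [sq]
  have hadd : z + w = 2 * r * Complex.cos t := by
    rw [hz, hw, Complex.cos]
    ring_nf
  have z1 : 1 - z ≠ 0 := fun h => by
    rw [← sub_eq_zero.1 h] at nz; simp at nz
  have w1 : 1 - w ≠ 0 := fun h => by
    rw [← sub_eq_zero.1 h] at nw; simp at nw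
  have key : (angularPoisson r t : ℂ) = (1 - z)⁻¹ + w * (1 - w)⁻¹ := by
    have : (1 - z) * (1 - w) = 1 - 2 * r * Complex.cos t + r ^ 2 := by
      rw [← hadd, ← hzw]; ring
    have e : (1 - z)⁻¹ + w * (1 - w)⁻¹ = (1 - z * w) / ((1 - z) * (1 - w)) := by
      field_simp; ring
    rw [e, this, hzw, angularPoisson]
    push_cast
    rfl
  rw [key]
  -- Nonnegative frequencies form the geometric series in `z`; negative ones form the series in `w`,
  -- starting at exponent `1`.
  refine HasSum.of_nat_of_neg_add_one ?_ ?_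
  · refine (hasSum_geometric_of_norm_lt_one nz).congr_fun fun n => ?_
    rw [hz, mul_pow, ← Complex.exp_nat_mul]
    simp only [Int.natAbs_natCast, Int.cast_natCast]
    ring_nf
  · refine ((hasSum_geometric_of_norm_lt_one nw).mul_left w).congr_fun fun n => ?_
    rw [← pow_succ', hw, mul_pow, ← Complex.exp_nat_mul]
    have : (-((n : ℤ) + 1)).natAbs = n + 1 := by omega
    rw [this]
    push_cast
    ring_nf

theorem abelMean_eq_integral {f : ℝ → ℂ} (hf : IntervalIntegrable f volume (-π) π) {r : ℝ}
    (h0 : 0 ≤ r) (h1 : r < 1) (x : ℝ) :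
    abelMean f r x = 1 / (2 * π) * ∫ y in (-π)..π, (angularPoisson r (x - y) : ℂ) * f y := by
  have hle : -π ≤ π := by linarith [pi_pos]
  have hf' : Integrable f (volume.restrict (Ioc (-π) π)) :=
    (intervalIntegrable_iff_integrableOn_Ioc_of_le hle).1 hf
  set F : ℤ → ℝ → ℂ := fun k y =>
    ((r : ℂ) ^ k.natAbs * Complex.exp (Complex.I * k * (x - y))) * f y with hF
  have hnorm : ∀ k y, ‖F k y‖ = r ^ k.natAbs * ‖f y‖ := by
    intro k y
    rw [hF]
    simp only [norm_mul, norm_pow, Complex.norm_real, Real.norm_eq_abs, abs_of_nonneg h0]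
    have : Complex.I * k * (x - y) = ((k * (x - y) : ℝ) : ℂ) * Complex.I := by
      push_cast; ring
    rw [this, Complex.norm_exp_ofReal_mul_I, mul_one]
  have hint : ∀ k, Integrable (F k) (volume.restrict (Ioc (-π) π)) := by
    intro k
    refine (hf'.norm.const_mul (r ^ k.natAbs)).mono' ?_ (.of_forall fun y => (hnorm k y).le)
    refine AEStronglyMeasurable.mul ?_ hf'.1
    exact Continuous.aestronglyMeasurable (by fun_prop)
  have hsumr : Summable (fun k : ℤ => r ^ k.natAbs) := by
    have h := (summable_geometric_of_lt_one h0 h1)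
    refine Summable.of_nat_of_neg_add_one (by simpa using h) ?_
    have : ∀ n : ℕ, (-((n : ℤ) + 1)).natAbs = n + 1 := by intro n; omega
    simp only [this]
    exact (summable_nat_add_iff 1).2 h
  have hs := hasSum_integral_of_summable_integral_norm hint (by
    simp only [hnorm, integral_const_mul]
    exact hsumr.mul_right _)
  have hs2 := (hs.mul_left (1 / (2 * π : ℂ))).tsum_eq
  rw [intervalIntegral.integral_of_le hle, abelMean]
  have hR : ∫ y in Ioc (-π) π, (angularPoisson r (x - y) : ℂ) * f y =
      ∫ y in Ioc (-π) π, ∑' k, F k y := by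
    refine integral_congr_ae (.of_forall fun y => ?_)
    have := ((hasSum_angularPoisson h0 h1 (x - y)).mul_right (f y)).tsum_eq
    simp only [hF]
    rw [← this]
    push_cast
    rfl
  rw [hR, ← hs2]
  refine tsum_congr fun k => ?_
  · rw [fourierCoefficient_eq, intervalIntegral.integral_of_le hle]
    have : ∀ y : ℝ, F k y = ((r : ℂ) ^ k.natAbs * Complex.exp (Complex.I * k * x)) *
        (f y * Complex.exp (-(Complex.I * k * y))) := by
      intro y
      rw [hF]
      simp only
      rw [show Complex.I * k * ((x : ℂ) - y) = Complex.I * k * x + -(Complex.I * k * y) by ring,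
        Complex.exp_add]
      ring
    simp only [this, integral_const_mul]
    ring

/-- This lets the limit value be subtracted from `f` under the Poisson integral. -/
theorem abelMean_const (L : ℂ) {r : ℝ} (x : ℝ) :
    abelMean (fun _ => L) r x = L := by
  have h : ∀ k : ℤ, fourierCoefficient (fun _ => L) k = if k = 0 then L else 0 := by
    intro k
    have hpi : (π : ℂ) ≠ 0 := by exact_mod_cast pi_ne_zero
    rw [fourierCoefficient_eq]
    split_ifs with hk
    · subst hk
      simp
      field_simp
      ring
    · rw [intervalIntegral.integral_const_mul]
      have : ∀ y : ℝ, Complex.exp (-(Complex.I * k * y)) = Complex.exp (-(Complex.I * k) * y) := by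
        intro y; ring_nf
      simp only [this]
      have hk' : (k : ℂ) ≠ 0 := by exact_mod_cast hk
      rw [integral_exp_mul_complex (by simp [hk'])]
      have : Complex.exp (-(Complex.I * k) * π) = Complex.exp (-(Complex.I * k) * (-π : ℝ)) := by
        rw [Complex.exp_eq_exp_iff_exists_int]
        exact ⟨-k, by push_cast; ring⟩
      rw [this]
      simp
  rw [abelMean, tsum_eq_single 0]
  · simp [h]
  · intro k hk
    simp [h, hk]

/-! ### Kernel bounds and Fatou's theorem -/

theorem one_sub_cos_ge {t : ℝ} (ht : |t| ≤ π) : 2 / π ^ 2 * t ^ 2 ≤ 1 - Real.cos t := by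
  have h1 := Real.mul_le_sin (x := |t| / 2) (by positivity) (by linarith)
  have h2 : 1 - Real.cos t = 2 * Real.sin (|t| / 2) ^ 2 := by
    rw [← Real.cos_abs, Real.sin_sq_eq_half_sub, show 2 * (|t| / 2) = |t| by ring]
    ring
  rw [h2, ← sq_abs t]
  have := pow_le_pow_left₀ (by positivity) h1 2
  calc _ = 2 * (2 / π * (|t| / 2)) ^ 2 := by field_simp
    _ ≤ _ := by linarith

theorem angularPoisson_nonneg {r : ℝ} (h0 : 0 ≤ r) (h1 : r < 1) (t : ℝ) :
    0 ≤ angularPoisson r t :=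
  div_nonneg (by nlinarith) (angularPoisson_denom_pos h1 h0 t).le

theorem angularPoisson_le {r : ℝ} (h0 : 1 / 2 ≤ r) (h1 : r < 1) {t : ℝ} (ht : |t| ≤ π) :
    angularPoisson r t ≤ 16 * ((1 - r) / ((1 - r) ^ 2 + t ^ 2)) := by
  have hr : 0 < 1 - r := by linarith
  have hd : ((1 - r) ^ 2 + t ^ 2) / 8 ≤ 1 - 2 * r * Real.cos t + r ^ 2 := by
    have h := one_sub_cos_ge ht
    have h3 : t ^ 2 / 8 ≤ 2 / π ^ 2 * t ^ 2 := by
      rw [div_eq_inv_mul]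
      refine mul_le_mul_of_nonneg_right ?_ (sq_nonneg t)
      rw [le_div_iff₀ (by positivity)]
      nlinarith [pi_pos, pi_le_four]
    nlinarith [mul_le_mul_of_nonneg_right h0 (sub_nonneg.2 (Real.cos_le_one t)), sq_nonneg (1 - r)]
  rw [angularPoisson, mul_div_assoc', div_le_div_iff₀ (angularPoisson_denom_pos h1 (by linarith) t)
    (by positivity)]
  have : (1 - r ^ 2) ≤ 2 * (1 - r) := by nlinarith
  have hp : 0 ≤ (1 - r) ^ 2 + t ^ 2 := by positivity
  nlinarith [mul_le_mul_of_nonneg_right this hp, mul_le_mul_of_nonneg_left hd hr.le]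

theorem angularPoisson_le_of_cos {r c : ℝ} (h0 : 1 / 2 ≤ r) (h1 : r < 1) (hc : 0 < c) {t : ℝ}
    (ht : c ≤ 1 - Real.cos t) : angularPoisson r t ≤ 2 / c * (1 - r) := by
  rw [angularPoisson, div_le_iff₀ (angularPoisson_denom_pos h1 (by linarith) t)]
  have hr : 0 < 1 - r := by linarith
  have : c ≤ 1 - 2 * r * Real.cos t + r ^ 2 := by
    nlinarith [mul_le_mul_of_nonneg_right h0 (sub_nonneg.2 (Real.cos_le_one t)), sq_nonneg (1 - r)]
  calc 1 - r ^ 2 ≤ 2 * (1 - r) := by nlinarith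
    _ = 2 / c * (1 - r) * c := by field_simp
    _ ≤ _ := by gcongr

/-- Dyadic shells: at distance about `2 ^ k * ρ` the kernel is at most `4 * 4⁻ᵏ / ρ`, while the mass
of `u` there is at most `ε * 2 ^ k * ρ`. The products sum to `8 * ε`, independently of `ρ`. -/
theorem lintegral_cauchy_kernel_le {u : ℝ → ℝ≥0∞} (hu : Measurable u) {x δ ε ρ : ℝ}
    (hδ : 0 < δ) (hε : 0 ≤ ε) (hρ : 0 < ρ)
    (h : ∀ s, 0 < s → s ≤ δ → ∫⁻ y in Icc (x - s) (x + s), u y ≤ ENNReal.ofReal (ε * s)) :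
    ∫⁻ y in Icc (x - δ) (x + δ), ENNReal.ofReal (ρ / (ρ ^ 2 + (x - y) ^ 2)) * u y ≤
      ENNReal.ofReal (8 * ε) := by
  set B : ℕ → Set ℝ := fun k => Icc (x - 2 ^ k * ρ) (x + 2 ^ k * ρ) with hB
  set c : ℕ → ℝ := fun k => 4 * (1 / 4) ^ k / ρ with hc
  have hpt : ∀ y, ENNReal.ofReal (ρ / (ρ ^ 2 + (x - y) ^ 2)) * u y ≤
      ∑' k, (B k).indicator (fun y => ENNReal.ofReal (c k) * u y) y := by
    intro y
    have hex : ∃ k : ℕ, |x - y| ≤ 2 ^ k * ρ := by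
      obtain ⟨k, hk⟩ := pow_unbounded_of_one_lt (|x - y| / ρ) (one_lt_two)
      exact ⟨k, by rw [div_lt_iff₀ hρ] at hk; exact hk.le⟩
    classical
    -- By minimality `|x - y| > 2 ^ (k - 1) * ρ` unless `k = 0`, and this yields the kernel bound `c
    -- k`.
    set k := Nat.find hex with hk
    have hk1 : |x - y| ≤ 2 ^ k * ρ := Nat.find_spec hex
    have hmem : y ∈ B k := by
      rw [abs_le] at hk1
      exact ⟨by linarith, by linarith⟩
    refine le_trans ?_ (ENNReal.le_tsum k)
    rw [indicator_of_mem hmem]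
    gcongr
    rw [hc]
    simp only
    rw [div_le_div_iff₀ (by positivity) hρ]
    rcases Nat.eq_zero_or_pos k with h0 | h0
    · rw [h0]; nlinarith [sq_nonneg (x - y)]
    · have hk2 : 2 ^ (k - 1) * ρ < |x - y| := by
        have := Nat.find_min hex (m := k - 1) (by omega)
        simpa using this
      have hk3 : (2 ^ (k - 1) * ρ) ^ 2 ≤ (x - y) ^ 2 := by
        rw [← sq_abs (x - y)]
        exact pow_le_pow_left₀ (by positivity) hk2.le 2
      obtain ⟨m, hm⟩ : ∃ m, k = m + 1 := ⟨k - 1, by omega⟩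
      rw [hm] at hk3 ⊢
      simp only [add_tsub_cancel_right] at hk3
      have e : (1 / 4 : ℝ) ^ (m + 1) * (2 ^ m * ρ) ^ 2 * 4 = ρ ^ 2 := by
        rw [mul_pow, ← pow_mul, mul_comm m 2, pow_mul, pow_succ]
        have : (1 / 4 : ℝ) ^ m * (2 ^ 2) ^ m = 1 := by rw [← mul_pow]; norm_num
        linear_combination ρ ^ 2 * this
      have := mul_le_mul_of_nonneg_left hk3 (by positivity : (0 : ℝ) ≤ (1 / 4) ^ (m + 1))
      have : 0 ≤ (1 / 4 : ℝ) ^ (m + 1) * ρ ^ 2 := by positivity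
      nlinarith
  calc _ ≤ ∫⁻ y in Icc (x - δ) (x + δ),
        ∑' k, (B k).indicator (fun y => ENNReal.ofReal (c k) * u y) y :=
        lintegral_mono hpt
    _ = ∑' k, ∫⁻ y in Icc (x - δ) (x + δ),
        (B k).indicator (fun y => ENNReal.ofReal (c k) * u y) y := by
        refine lintegral_tsum fun k => ?_
        exact ((hu.const_mul _).indicator measurableSet_Icc).aemeasurable
    _ ≤ ∑' k, ENNReal.ofReal (4 * ε * (1 / 2) ^ k) := by
        refine ENNReal.tsum_le_tsum fun k => ?_
        rw [lintegral_indicator measurableSet_Icc, Measure.restrict_restrict measurableSet_Icc,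
          lintegral_const_mul _ hu]
        have hsub : B k ∩ Icc (x - δ) (x + δ) ⊆
            Icc (x - min (2 ^ k * ρ) δ) (x + min (2 ^ k * ρ) δ) := by
          rintro y ⟨⟨h1, h2⟩, h3, h4⟩
          constructor
          · rcases min_choice (2 ^ k * ρ) δ with e | e <;> rw [e] <;> assumption
          · rcases min_choice (2 ^ k * ρ) δ with e | e <;> rw [e] <;> assumption
        calc _ ≤ ENNReal.ofReal (c k) * ENNReal.ofReal (ε * min (2 ^ k * ρ) δ) := by
              gcongr
              exact (lintegral_mono_set hsub).trans
                (h _ (lt_min (by positivity) hδ) (min_le_right _ _))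
          _ ≤ ENNReal.ofReal (c k) * ENNReal.ofReal (ε * (2 ^ k * ρ)) := by
              gcongr
              exact min_le_left _ _
          _ = ENNReal.ofReal (4 * ε * (1 / 2) ^ k) := by
              rw [← ENNReal.ofReal_mul (by positivity)]
              congr 1
              rw [hc]
              have : (1 / 4 : ℝ) ^ k * 2 ^ k = (1 / 2) ^ k := by rw [← mul_pow]; norm_num
              simp only
              rw [← this]
              field_simp
    _ = ENNReal.ofReal (8 * ε) := by
        rw [← ENNReal.ofReal_tsum_of_nonneg (fun k => by positivity)
          (summable_geometric_two.mul_left _), tsum_mul_left, tsum_geometric_two]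
        congr 1
        ring

/-- Fatou's theorem: at a Lebesgue point, the Abel means converge to the Lebesgue value. -/
theorem tendsto_abelMean_of_lebesguePoint {f : ℝ → ℂ} (hf : Measurable f)
    (hfi : IntegrableOn f (Icc (-π) π)) {x : ℝ} (hx : x ∈ Ioo (-π) π) {L : ℂ}
    (h : ∀ ε > 0, ∃ δ > 0, ∀ s, 0 < s → s ≤ δ →
      ∫⁻ y in Icc (x - s) (x + s), ‖f y - L‖ₑ ≤ ENNReal.ofReal (ε * s)) :
    Tendsto (fun r : ℝ => abelMean f r x) (𝓝[<] 1) (𝓝 L) := by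
  have hle : -π ≤ π := by linarith [pi_pos]
  rw [Metric.tendsto_nhdsWithin_nhds]
  intro ε' hε'
  -- The near part costs `16 * 8 * ε`, which is half of `ε'`; the far part gets the other half.
  set ε := ε' / 256 with hεdef
  have hε : 0 < ε := by positivity
  obtain ⟨δ₀, hδ₀, hδ₀'⟩ := h ε hε
  obtain ⟨δ, hδ, hδδ, hδ1, hδ2⟩ : ∃ δ > 0, δ ≤ δ₀ ∧ -π ≤ x - δ ∧ x + δ ≤ π := by
    refine ⟨min δ₀ (min (x + π) (π - x)), ?_, min_le_left _ _, ?_, ?_⟩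
    · exact lt_min hδ₀ (lt_min (by linarith [hx.1]) (by linarith [hx.2]))
    · linarith [(min_le_right δ₀ (min (x + π) (π - x))).trans (min_le_left _ _)]
    · linarith [(min_le_right δ₀ (min (x + π) (π - x))).trans (min_le_right _ _)]
  have hloc : ∀ s, 0 < s → s ≤ δ →
      ∫⁻ y in Icc (x - s) (x + s), ‖f y - L‖ₑ ≤ ENNReal.ofReal (ε * s) :=
    fun s h1 h2 => hδ₀' s h1 (h2.trans hδδ)
  have hu : Measurable fun y => ‖f y - L‖ₑ := (hf.sub_const L).enorm
  have hgi : IntegrableOn (fun y => f y - L) (Icc (-π) π) :=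
    hfi.sub (integrableOn_const (by simp))
  set m : ℝ := (∫⁻ y in Icc (-π) π, ‖f y - L‖ₑ).toReal with hm
  have hmm : ∫⁻ y in Icc (-π) π, ‖f y - L‖ₑ = ENNReal.ofReal m :=
    (ENNReal.ofReal_toReal hgi.2.ne).symm
  have hm0 : 0 ≤ m := ENNReal.toReal_nonneg
  -- Since `x` is interior, `|x - y| < 2π`, so the cosine equals `1` only at `y = x`; compactness
  -- makes the gap uniform.
  obtain ⟨c, hc, hcK⟩ : ∃ c : ℝ, 0 < c ∧ ∀ y ∈ Icc (-π) π \ Ioo (x - δ) (x + δ),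
      c ≤ 1 - Real.cos (x - y) := by
    refine (isCompact_Icc.diff isOpen_Ioo).exists_forall_le' (by fun_prop) ?_
    rintro y ⟨hy, hy'⟩
    rw [sub_pos]
    refine lt_of_le_of_ne (Real.cos_le_one _) fun he => hy' ?_
    rw [Real.cos_eq_one_iff_of_lt_of_lt (by linarith [hx.1, hy.2]) (by linarith [hx.2, hy.1])] at he
    have : y = x := by linarith
    rw [this]
    constructor <;> linarith
  refine ⟨min (1 / 2) (ε' / (2 * (2 / c * m + 1))), by positivity, ?_⟩
  intro r hr1 hrd
  have hr1 : r < 1 := hr1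
  rw [Real.dist_eq, abs_sub_comm, abs_of_pos (by linarith), lt_min_iff] at hrd
  have hr2 : 1 / 2 ≤ r := by linarith [hrd.1]
  have hr0 : 0 ≤ r := by linarith
  have hrep : abelMean f r x - L =
      1 / (2 * π) * ∫ y in (-π)..π, (angularPoisson r (x - y) : ℂ) * (f y - L) := by
    have h1 : IntervalIntegrable f volume (-π) π :=
      (intervalIntegrable_iff_integrableOn_Icc_of_le hle).2 hfi
    have hPc : Continuous fun y : ℝ => (angularPoisson r (x - y) : ℂ) := by
      refine Complex.continuous_ofReal.comp ?_
      unfold angularPoisson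
      exact Continuous.div (by fun_prop) (by fun_prop)
        fun y => (angularPoisson_denom_pos hr1 hr0 _).ne'
    conv_lhs => rw [← abelMean_const L (r := r) x]
    rw [abelMean_eq_integral h1 hr0 hr1, abelMean_eq_integral (by simp) hr0 hr1, ← mul_sub,
      ← intervalIntegral.integral_sub (h1.continuousOn_mul hPc.continuousOn)
        (IntervalIntegrable.continuousOn_mul (by simp) hPc.continuousOn)]
    simp only [mul_sub]
  have hB1 : ∫⁻ y in Icc (x - δ) (x + δ), ENNReal.ofReal (angularPoisson r (x - y)) * ‖f y - L‖ₑ ≤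
      ENNReal.ofReal (128 * ε) := by
    have hk := lintegral_cauchy_kernel_le hu hδ hε.le (sub_pos.2 hr1) hloc
    calc _ ≤ ∫⁻ y in Icc (x - δ) (x + δ), ENNReal.ofReal 16 *
          (ENNReal.ofReal ((1 - r) / ((1 - r) ^ 2 + (x - y) ^ 2)) * ‖f y - L‖ₑ) := by
          refine setLIntegral_mono' measurableSet_Icc fun y hy => ?_
          rw [← mul_assoc, ← ENNReal.ofReal_mul (by norm_num)]
          gcongr
          refine angularPoisson_le hr2 hr1 (abs_le.2 ⟨?_, ?_⟩)
          · linarith [hy.2, hx.1]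
          · linarith [hy.1, hx.2]
      _ ≤ ENNReal.ofReal 16 * ENNReal.ofReal (8 * ε) := by
          rw [lintegral_const_mul' _ _ ENNReal.ofReal_ne_top]
          gcongr
      _ = _ := by rw [← ENNReal.ofReal_mul (by norm_num)]; ring_nf
  have hB2 : ∫⁻ y in Icc (-π) π \ Ioo (x - δ) (x + δ),
      ENNReal.ofReal (angularPoisson r (x - y)) * ‖f y - L‖ₑ ≤
      ENNReal.ofReal (2 / c * (1 - r) * m) := by
    have hpos : 0 ≤ 2 / c * (1 - r) := mul_nonneg (by positivity) (by linarith)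
    calc _ ≤ ∫⁻ y in Icc (-π) π \ Ioo (x - δ) (x + δ),
          ENNReal.ofReal (2 / c * (1 - r)) * ‖f y - L‖ₑ := by
          refine setLIntegral_mono' (measurableSet_Icc.diff measurableSet_Ioo) fun y hy => ?_
          gcongr
          exact angularPoisson_le_of_cos hr2 hr1 hc (hcK y hy)
      _ ≤ ∫⁻ y in Icc (-π) π, ENNReal.ofReal (2 / c * (1 - r)) * ‖f y - L‖ₑ :=
          lintegral_mono_set sdiff_subset
      _ = _ := by
          rw [lintegral_const_mul' _ _ ENNReal.ofReal_ne_top, hmm, ← ENNReal.ofReal_mul hpos]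
  have hsplit : ‖∫ y in (-π)..π, (angularPoisson r (x - y) : ℂ) * (f y - L)‖ₑ ≤
      ENNReal.ofReal (128 * ε + 2 / c * (1 - r) * m) := by
    rw [intervalIntegral.integral_of_le hle, ← integral_Icc_eq_integral_Ioc]
    refine (enorm_integral_le_lintegral_enorm _).trans ?_
    have he : ∀ y, ‖(angularPoisson r (x - y) : ℂ) * (f y - L)‖ₑ =
        ENNReal.ofReal (angularPoisson r (x - y)) * ‖f y - L‖ₑ := by
      intro y
      rw [enorm_mul]
      congr 1
      rw [← ofReal_norm, Complex.norm_real, Real.norm_eq_abs,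
        abs_of_nonneg (angularPoisson_nonneg hr0 hr1 _)]
    simp only [he]
    have hsub : Icc (-π) π ⊆ Icc (x - δ) (x + δ) ∪ (Icc (-π) π \ Ioo (x - δ) (x + δ)) := by
      intro y hy
      by_cases h : y ∈ Ioo (x - δ) (x + δ)
      · exact Or.inl (Ioo_subset_Icc_self h)
      · exact Or.inr ⟨hy, h⟩
    refine (lintegral_mono_set hsub).trans ((lintegral_union_le _ _ _).trans ?_)
    rw [ENNReal.ofReal_add (by positivity)
      (mul_nonneg (mul_nonneg (by positivity) (by linarith)) hm0)]
    exact add_le_add hB1 hB2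
  have hnorm : ‖∫ y in (-π)..π, (angularPoisson r (x - y) : ℂ) * (f y - L)‖ ≤
      128 * ε + 2 / c * (1 - r) * m := by
    rw [← ofReal_norm] at hsplit
    exact (ENNReal.ofReal_le_ofReal_iff (add_nonneg (by positivity)
      (mul_nonneg (mul_nonneg (by positivity) (by linarith)) hm0))).1 hsplit
  rw [dist_eq_norm, hrep, norm_mul]
  have hpi : ‖(1 / (2 * π) : ℂ)‖ ≤ 1 := by
    rw [norm_div, norm_mul, Complex.norm_real]
    simp only [norm_one, Complex.norm_ofNat, Real.norm_eq_abs, abs_of_pos pi_pos]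
    rw [div_le_one (by positivity)]
    linarith [pi_gt_three]
  have hlast : 2 / c * (1 - r) * m < ε' / 2 := by
    have h1 := hrd.2
    rw [lt_div_iff₀ (by positivity)] at h1
    nlinarith
  calc _ ≤ 1 * (128 * ε + 2 / c * (1 - r) * m) := by gcongr
    _ < ε' := by rw [hεdef]; linarith

/-! ### Covers, dyadic grids and rotations -/

/-- A countable family is padded to a sequence by arcs of length `0`, which are free because `h 0 =
0`. -/
theorem hausdorffContent_le_tsum {ι : Type*} [Countable ι] {h : ℝ → ℝ} (h_zero : h 0 = 0)
    {A : Set Circle} {a l : ι → ℝ} (hl : ∀ i, l i ∈ Icc (0 : ℝ) 1)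
    (hA : A ⊆ ⋃ i, circleArc (a i) (l i)) :
    hausdorffContent h A ≤ ∑' i, ENNReal.ofReal (h (l i)) := by
  obtain ⟨e, he⟩ := exists_injective_nat ι
  have h1 : ∀ k, Function.extend e l 0 k ∈ Icc (0 : ℝ) 1 := by
    intro k
    by_cases hk : ∃ i, e i = k
    · obtain ⟨i, rfl⟩ := hk
      rw [he.extend_apply]
      exact hl i
    · rw [Function.extend_apply' _ _ _ hk]
      simp
  have h2 : A ⊆ ⋃ k, circleArc (Function.extend e a 0 k) (Function.extend e l 0 k) := by
    refine hA.trans (iUnion_subset fun i => ?_)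
    refine subset_iUnion_of_subset (e i) ?_
    rw [he.extend_apply, he.extend_apply]
  refine (iInf₂_le_of_le _ _ (iInf₂_le h1 h2)).trans (le_of_eq ?_)
  rw [← he.tsum_eq]
  · simp only [he.extend_apply]
  · intro k hk
    by_contra hk'
    refine hk ?_
    have : ¬ ∃ i, e i = k := hk'
    simp [Function.extend_apply' _ _ _ this, h_zero]

/-- The length of the cells of the grid that divides the circle into `2 ^ n` equal arcs. -/
noncomputable def cellLength (n : ℕ) : ℝ := 2 * π / 2 ^ n

/-- The index of the cell of the `n`-th grid that contains `x`. -/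
noncomputable def cellIndex (n : ℕ) (x : ℝ) : ℤ := ⌊(x + π) / cellLength n⌋

theorem cellLength_pos (n : ℕ) : 0 < cellLength n := by
  unfold cellLength
  positivity

theorem cellLength_succ (n : ℕ) : cellLength n = 2 * cellLength (n + 1) := by
  unfold cellLength
  rw [pow_succ]
  field_simp

theorem two_pow_mul_cellLength (n : ℕ) : 2 ^ n * cellLength n = 2 * π := by
  unfold cellLength
  field_simp

theorem cellIndex_eq_iff {n : ℕ} {x : ℝ} {j : ℤ} : cellIndex n x = j ↔
    -π + j * cellLength n ≤ x ∧ x < -π + j * cellLength n + cellLength n := by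
  have := cellLength_pos n
  rw [cellIndex, Int.floor_eq_iff, le_div_iff₀ this, div_lt_iff₀ this]
  constructor <;> rintro ⟨h1, h2⟩ <;> constructor <;> linarith

theorem measurable_cellIndex (n : ℕ) : Measurable (cellIndex n) :=
  Int.measurable_floor.comp ((measurable_id.add_const π).div_const _)

/-- Every point of `E` can be rotated into cell `j` without leaving `E`, so a cover of one cell,
rotated `2 ^ N` times, covers everything. -/
theorem hausdorffContent_le_of_cell_cover {ι : Type*} [Countable ι] {h : ℝ → ℝ}
    (h_zero : h 0 = 0) {E : Set ℝ} (hE_sub : E ⊆ Icc (-π) π) {N : ℕ}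
    (hE_inv : ∀ x ∈ E, ∀ k : ℤ, ∃ m : ℤ, x + 2 * π * k / 2 ^ N + 2 * π * m ∈ E)
    {j : ℤ} (hj1 : 1 ≤ j) (hj2 : j + 1 ≤ 2 ^ N) {a l : ι → ℝ} (hl : ∀ i, l i ∈ Icc (0 : ℝ) 1)
    (hcov : ∀ x ∈ E, cellIndex N x = j → ∃ i, x ∈ Icc (a i) (a i + l i)) :
    hausdorffContent h (Circle.exp '' E) ≤ 2 ^ N * ∑' i, ENNReal.ofReal (h (l i)) := by
  set s := cellLength N with hs
  have hs0 : 0 < s := cellLength_pos N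
  have hs2 : 2 ^ N * s = 2 * π := two_pow_mul_cellLength N
  have key := hausdorffContent_le_tsum (ι := Fin (2 ^ N) × ι) h_zero (A := Circle.exp '' E)
    (a := fun q => a q.2 - s * (q.1 : ℕ)) (l := fun q => l q.2) (fun q => hl q.2) ?_
  · refine key.trans (le_of_eq ?_)
    rw [ENNReal.tsum_prod (f := fun (_ : Fin (2 ^ N)) i => ENNReal.ofReal (h (l i))), tsum_fintype]
    simp
  · rintro _ ⟨x, hx, rfl⟩
    set k₀ : ℤ := j - cellIndex N x with hk₀
    set y := x + s * k₀ with hy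
    have hyj : cellIndex N y = j := by
      have := (cellIndex_eq_iff (n := N) (x := x)).1 rfl
      rw [cellIndex_eq_iff, hy, hk₀]
      push_cast
      constructor <;> nlinarith
    have hyE : y ∈ E := by
      obtain ⟨m, hm⟩ := hE_inv x hx k₀
      have hym : x + 2 * π * k₀ / 2 ^ N + 2 * π * m = y + 2 * π * m := by
        rw [hy, hs, cellLength]; ring
      rw [hym] at hm
      have hb := hE_sub hm
      have hy' := cellIndex_eq_iff.1 hyj
      rw [← hs] at hy'
      have hj1' : (1 : ℝ) ≤ j := by exact_mod_cast hj1
      have hj2' : (j : ℝ) + 1 ≤ 2 ^ N := by exact_mod_cast hj2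
      have hy1 : -π < y := by nlinarith [hy'.1]
      have hy2 : y < π := by nlinarith [hy'.2, mul_le_mul_of_nonneg_right hj2' hs0.le]
      -- The bounds on `j` put `y` strictly inside `(-π, π)`, so no other translate of `y` by a
      -- multiple of `2π` lies in `[-π, π]`.
      have hm0 : m = 0 := by
        have l1 : (m : ℝ) < 1 := by
          have : 2 * π * m < 2 * π * 1 := by linarith [hb.2]
          exact lt_of_mul_lt_mul_left this (by positivity)
        have l2 : (-1 : ℝ) < m := by
          have : 2 * π * (-1) < 2 * π * m := by linarith [hb.1]
          exact lt_of_mul_lt_mul_left this (by positivity)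
        have l1' : m < 1 := by exact_mod_cast l1
        have l2' : -1 < m := by exact_mod_cast l2
        omega
      simpa [hm0] using hm
    obtain ⟨i, hi⟩ := hcov y hyE hyj
    -- Full turns do not move a point of the circle, so only `k₀` modulo `2 ^ N` matters.
    have hpos : (0 : ℤ) < 2 ^ N := by positivity
    have hr0 := Int.emod_nonneg k₀ hpos.ne'
    have hr1 := Int.emod_lt_of_pos k₀ hpos
    have hlt : (k₀ % 2 ^ N).toNat < 2 ^ N := by
      zify
      rw [Int.toNat_of_nonneg hr0]
      exact hr1
    refine mem_iUnion.2 ⟨(⟨(k₀ % 2 ^ N).toNat, hlt⟩, i), ?_⟩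
    have hcast : (((k₀ % 2 ^ N).toNat : ℕ) : ℝ) = k₀ - 2 ^ N * (k₀ / 2 ^ N : ℤ) := by
      have h1 : (((k₀ % 2 ^ N).toNat : ℕ) : ℤ) = k₀ - 2 ^ N * (k₀ / 2 ^ N : ℤ) := by
        rw [Int.toNat_of_nonneg hr0]
        have := Int.emod_add_mul_ediv k₀ (2 ^ N)
        linarith
      exact_mod_cast h1
    refine ⟨x + (k₀ / 2 ^ N : ℤ) * (2 * π), ?_, ?_⟩
    · simp only [hcast]
      have e : x + (k₀ / 2 ^ N : ℤ) * (2 * π) = y - s * (k₀ - 2 ^ N * (k₀ / 2 ^ N : ℤ)) := by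
        rw [hy, ← hs2]; ring
      rw [e]
      constructor <;> linarith [hi.1, hi.2]
    · exact Circle.periodic_exp.int_mul (k₀ / 2 ^ N) x

/-! ### The gauge series, the energy series and the thresholds -/

/-- Integral test on dyadic intervals: on `(2^(-m-1), 2^(-m))` the gauge is at least its value at
the left end, `8 / 2 ^ (m + 4)`, and `log (e / x)` grows linearly in `m`. The squared logarithm is
thus the factor `n ^ 2`. -/
theorem summable_gauge {α : ℝ} (hα0 : 0 < α) (hα1 : α < 1)
    {h : ℝ → ℝ} (h_mono : MonotoneOn h (Icc 0 1))
    (h_ge : ∀ x ∈ Ico (0 : ℝ) 1, x ≤ h x)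
    (h_int : IntegrableOn
      (fun x : ℝ => h x / x ^ (2 - α) * Real.log (Real.exp 1 / x) ^ 2) (Ioo 0 1)) :
    Summable fun n : ℕ => (n : ℝ) ^ 2 * (cellLength n ^ (α - 1) * h (8 / 2 ^ n)) := by
  set φ : ℝ → ℝ := fun x => h x / x ^ (2 - α) * Real.log (Real.exp 1 / x) ^ 2 with hφ
  set J : ℕ → Set ℝ := fun m => Ioo ((1 / 2) ^ (m + 1)) ((1 / 2) ^ m) with hJ
  have hlen : ∀ m : ℕ, ((1 : ℝ) / 2) ^ m = 2 * (1 / 2) ^ (m + 1) := fun m => by rw [pow_succ]; ring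
  have hle1 : ∀ m : ℕ, ((1 : ℝ) / 2) ^ m ≤ 1 := fun m => pow_le_one₀ (by norm_num) (by norm_num)
  have hJsub : ∀ m, J m ⊆ Ioo 0 1 := fun m x hx =>
    ⟨lt_trans (by positivity) hx.1, hx.2.trans_le (hle1 m)⟩
  have hdisj : Pairwise (Function.onFun Disjoint J) := by
    refine (pairwise_disjoint_on J).2 fun m n hmn => ?_
    refine disjoint_left.2 fun x hx hx' => ?_
    have : ((1 : ℝ) / 2) ^ n ≤ (1 / 2) ^ (m + 1) :=
      pow_le_pow_of_le_one (by norm_num) (by norm_num) hmn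
    linarith [hx.1, hx'.2]
  have hsum : Summable fun m => ∫ x in J m, φ x :=
    (hasSum_integral_iUnion (fun m => measurableSet_Ioo) hdisj
      (h_int.mono_set (iUnion_subset hJsub))).summable
  rw [← summable_nat_add_iff 4]
  have hnn : ∀ m : ℕ, 0 ≤ h ((1 / 2) ^ (m + 1)) := fun m =>
    le_trans (by positivity) (h_ge _ ⟨by positivity, by
      have := hle1 m; rw [hlen] at this; nlinarith [pow_pos (one_half_pos (α := ℝ)) (m + 1)]⟩)
  have h8 : ∀ m : ℕ, (8 : ℝ) / 2 ^ (m + 4) = (1 / 2) ^ (m + 1) := by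
    intro m
    rw [one_div, inv_pow, pow_add, pow_add]
    field_simp
    norm_num
  refine Summable.of_nonneg_of_le (fun m => ?_) (fun m => ?_) (hsum.mul_left 128)
  · have := hnn m
    rw [h8]
    have := cellLength_pos (m + 4)
    positivity
  · rw [h8]
    set l : ℝ := (1 / 2) ^ (m + 1) with hl
    have hl0 : 0 < l := by positivity
    have h2l : 2 * l ≤ 1 := by rw [hl, ← hlen]; exact hle1 m
    have hhl := hnn m
    rw [← hl] at hhl
    have hlog2 : (1 : ℝ) / 4 ≤ Real.log 2 := by linarith [Real.log_two_gt_d9]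
    have hlow : ∀ x ∈ J m, h l / (2 * l) ^ (2 - α) * (((m : ℝ) + 4) / 4) ^ 2 ≤ φ x := by
      intro x hx
      have hx01 := hJsub m hx
      have hxl : l < x := hx.1
      have hx2 : x < 2 * l := by rw [hl, ← hlen]; exact hx.2
      have h1 : h l ≤ h x := h_mono ⟨hl0.le, by linarith⟩ ⟨hx01.1.le, hx01.2.le⟩ hxl.le
      have h2 : x ^ (2 - α) ≤ (2 * l) ^ (2 - α) :=
        Real.rpow_le_rpow hx01.1.le hx2.le (by linarith)
      have h3 : ((m : ℝ) + 4) / 4 ≤ Real.log (Real.exp 1 / x) := by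
        rw [Real.log_div (Real.exp_pos 1).ne' hx01.1.ne', Real.log_exp]
        have : Real.log x ≤ Real.log ((1 / 2) ^ m) := Real.log_le_log hx01.1 hx.2.le
        rw [Real.log_pow, one_div, Real.log_inv] at this
        nlinarith [mul_le_mul_of_nonneg_left hlog2 (Nat.cast_nonneg (α := ℝ) m)]
      have hxp : 0 < x ^ (2 - α) := Real.rpow_pos_of_pos hx01.1 _
      simp only [hφ]
      have h0 : 0 ≤ h x := hhl.trans h1
      gcongr
    have hI : l * (h l / (2 * l) ^ (2 - α) * (((m : ℝ) + 4) / 4) ^ 2) ≤ ∫ x in J m, φ x := by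
      have hfin : volume (J m) ≠ ∞ := by simp [hJ]
      have := setIntegral_mono_on (integrableOn_const (μ := volume) hfin)
        (h_int.mono_set (hJsub m)) measurableSet_Ioo hlow
      rw [setIntegral_const] at this
      have hv : volume.real (J m) = l := by
        rw [hJ, Real.volume_real_Ioo_of_le (pow_le_pow_of_le_one (by norm_num) (by norm_num)
          (Nat.le_succ m)), hlen, ← hl]
        ring
      rwa [hv, smul_eq_mul] at this
    have hs : l / 2 ≤ cellLength (m + 4) := by
      have e : l / 2 = 4 / 2 ^ (m + 4) := by rw [hl, ← h8]; ring
      rw [e, cellLength]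
      gcongr
      linarith [pi_gt_three]
    have hs1 : cellLength (m + 4) ^ (α - 1) ≤ 8 * l / (2 * l) ^ (2 - α) := by
      calc _ ≤ (l / 2) ^ (α - 1) :=
            Real.rpow_le_rpow_of_nonpos (by positivity) hs (by linarith)
        _ = (2 * l) ^ (α - 1) * 4 ^ (1 - α) := by
            rw [show l / 2 = 2 * l * 4⁻¹ by ring, Real.mul_rpow (by positivity) (by norm_num),
              Real.inv_rpow (by norm_num), ← Real.rpow_neg (by norm_num), neg_sub]
        _ ≤ (2 * l) ^ (α - 1) * 4 ^ (1 : ℝ) := by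
            gcongr
            · norm_num
            · linarith
        _ = 8 * l / (2 * l) ^ (2 - α) := by
            rw [show α - 1 = 1 - (2 - α) by ring, Real.rpow_sub (by positivity), Real.rpow_one,
              Real.rpow_one]
            ring
    push_cast
    calc _ ≤ ((m : ℝ) + 4) ^ 2 * (8 * l / (2 * l) ^ (2 - α) * h l) := by gcongr
      _ = 128 * (l * (h l / (2 * l) ^ (2 - α) * (((m : ℝ) + 4) / 4) ^ 2)) := by ring
      _ ≤ _ := by gcongr

theorem tsum_two_pow_div_le {B : ℝ} (hB : 0 < B) :
    ∑' n : ℕ, ENNReal.ofReal (if (2 : ℝ) ^ n ≤ B then 2 ^ n / B else 0) ≤ ENNReal.ofReal 2 := by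
  -- The second bound drives the induction: while `2 ^ m ≤ B` it keeps the partial sum at most `1`
  -- before the new term is added.
  have h : ∀ m : ℕ, ∑ n ∈ Finset.range m, (if (2 : ℝ) ^ n ≤ B then 2 ^ n / B else 0) ≤ 2 ∧
      ∑ n ∈ Finset.range m, (if (2 : ℝ) ^ n ≤ B then 2 ^ n / B else 0) ≤ 2 ^ m / B := by
    intro m
    induction m with
    | zero => simp [hB.le]
    | succ m ih =>
      rw [Finset.sum_range_succ]
      have e : (2 : ℝ) ^ (m + 1) / B = 2 ^ m / B + 2 ^ m / B := by rw [pow_succ]; ring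
      have hp : 0 ≤ (2 : ℝ) ^ m / B := by positivity
      split_ifs with hm
      · have : (2 : ℝ) ^ m / B ≤ 1 := (div_le_one hB).2 hm
        constructor <;> linarith [ih.1, ih.2]
      · constructor <;> linarith [ih.1, ih.2]
  have hnn : ∀ n : ℕ, 0 ≤ (if (2 : ℝ) ^ n ≤ B then 2 ^ n / B else 0) := by
    intro n
    split_ifs <;> positivity
  refine ENNReal.tsum_le_of_sum_range_le fun m => ?_
  rw [← ENNReal.ofReal_sum_of_nonneg fun n _ => hnn n]
  exact ENNReal.ofReal_le_ofReal (h m).1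

/-- The part of the quadratic oscillation of `f` at `y` that comes from points within `t`. -/
noncomputable def localOscillation (f : ℝ → ℂ) (t y : ℝ) : ℝ≥0∞ :=
  ∫⁻ z in Icc (-π) π, if |y - z| ≤ t then ‖f y - f z‖ₑ ^ 2 else 0

theorem measurable_localOscillation_kernel {f : ℝ → ℂ} (hf : Measurable f) (t : ℝ) :
    Measurable fun p : ℝ × ℝ => if |p.1 - p.2| ≤ t then ‖f p.1 - f p.2‖ₑ ^ 2 else 0 := by
  refine Measurable.ite (measurableSet_le (by fun_prop) measurable_const) ?_ measurable_const
  exact ((hf.comp measurable_fst).sub (hf.comp measurable_snd)).enorm.pow_const 2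

theorem measurable_localOscillation {f : ℝ → ℂ} (hf : Measurable f) (t : ℝ) :
    Measurable (localOscillation f t) :=
  (measurable_localOscillation_kernel hf t).lintegral_prod_right'

/-- For a pair at distance `t`, only scales with `t ≤ 3 s_n` contribute. There `s_n^(-(1+α)) ≤ 9
t^(-(1+α)) * (t / (3 s_n))`, because `1 ≤ 1 + α ≤ 2`, and the last factor sums geometrically to at
most `2`; hence `18`. -/
theorem tsum_localOscillation_le {α : ℝ} (hα0 : 0 < α) (hα1 : α < 1) {f : ℝ → ℂ}
    (hf : Measurable f) :
    ∑' n : ℕ, ENNReal.ofReal (cellLength n ^ (1 + α))⁻¹ *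
      ∫⁻ y in Icc (-π) π, localOscillation f (3 * cellLength n) y ≤
      ENNReal.ofReal 18 * ∫⁻ x in Icc (-π) π, ∫⁻ y in Icc (-π) π,
        ‖f x - f y‖ₑ ^ 2 / ENNReal.ofReal (|x - y| ^ (1 + α)) := by
  set w : ℕ → ℝ≥0∞ := fun n => ENNReal.ofReal (cellLength n ^ (1 + α))⁻¹ with hw
  have hk := fun n => measurable_localOscillation_kernel hf (3 * cellLength n)
  have hpt : ∀ y z : ℝ, ∑' n, w n * (if |y - z| ≤ 3 * cellLength n then ‖f y - f z‖ₑ ^ 2 else 0) ≤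
      ENNReal.ofReal 18 * (‖f y - f z‖ₑ ^ 2 / ENNReal.ofReal (|y - z| ^ (1 + α))) := by
    intro y z
    rcases eq_or_ne y z with rfl | hyz
    · simp
    have ht : 0 < |y - z| := abs_pos.2 (sub_ne_zero.2 hyz)
    set t := |y - z|
    have htp : 0 < t ^ (1 + α) := Real.rpow_pos_of_pos ht _
    set B := 6 * π / t with hB
    have hB0 : 0 < B := by positivity
    have hiff : ∀ n, t ≤ 3 * cellLength n ↔ (2 : ℝ) ^ n ≤ B := by
      intro n
      rw [hB, cellLength, le_div_iff₀ ht, mul_div_assoc', le_div_iff₀ (by positivity)]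
      constructor <;> intro h <;> linarith
    have hterm : ∀ n, w n * (if t ≤ 3 * cellLength n then ‖f y - f z‖ₑ ^ 2 else 0) ≤
        ENNReal.ofReal (if (2 : ℝ) ^ n ≤ B then 2 ^ n / B else 0) *
          (ENNReal.ofReal (9 / t ^ (1 + α)) * ‖f y - f z‖ₑ ^ 2) := by
      intro n
      by_cases hn : t ≤ 3 * cellLength n
      · rw [if_pos hn, if_pos ((hiff n).1 hn), ← mul_assoc, ← ENNReal.ofReal_mul (by positivity)]
        refine mul_le_mul_left ?_ _
        have hc := cellLength_pos n
        have hcp : 0 < cellLength n ^ (1 + α) := Real.rpow_pos_of_pos hc _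
        have h1 : (2 : ℝ) ^ n / B = t / (3 * cellLength n) := by
          rw [hB, cellLength]; field_simp; norm_num
        have h2 : (t / (3 * cellLength n)) ^ (1 + α) ≤ (t / (3 * cellLength n)) ^ (1 : ℝ) :=
          Real.rpow_le_rpow_of_exponent_ge (by positivity)
            ((div_le_one (by positivity)).2 hn) (by linarith)
        have h3 : (3 : ℝ) ^ (1 + α) ≤ 9 := by
          calc (3 : ℝ) ^ (1 + α) ≤ 3 ^ (2 : ℝ) :=
                Real.rpow_le_rpow_of_exponent_le (by norm_num) (by linarith)
            _ = 9 := by norm_num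
        rw [Real.rpow_one, Real.div_rpow ht.le (by positivity),
          Real.mul_rpow (by norm_num) hc.le, ← h1] at h2
        have h4 : 0 < (3 : ℝ) ^ (1 + α) := by positivity
        refine ENNReal.ofReal_le_ofReal ?_
        calc (cellLength n ^ (1 + α))⁻¹
            = t ^ (1 + α) / (3 ^ (1 + α) * cellLength n ^ (1 + α)) *
              (3 ^ (1 + α) / t ^ (1 + α)) := by field_simp
          _ ≤ 2 ^ n / B * (9 / t ^ (1 + α)) := by gcongr
      · rw [if_neg hn]; simp
    refine (ENNReal.tsum_le_tsum hterm).trans ?_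
    rw [ENNReal.tsum_mul_right]
    refine (mul_le_mul_left (tsum_two_pow_div_le hB0) _).trans (le_of_eq ?_)
    rw [← mul_assoc, ← ENNReal.ofReal_mul (by norm_num), ENNReal.div_eq_inv_mul,
      ← ENNReal.ofReal_inv_of_pos htp, ← mul_assoc, ← ENNReal.ofReal_mul (by norm_num)]
    congr 2
    ring
  have hin : ∀ y, ∑' n, w n * localOscillation f (3 * cellLength n) y =
      ∫⁻ z in Icc (-π) π, ∑' n, w n *
        (if |y - z| ≤ 3 * cellLength n then ‖f y - f z‖ₑ ^ 2 else 0) := by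
    intro y
    have hky : ∀ n, Measurable fun z =>
        if |y - z| ≤ 3 * cellLength n then ‖f y - f z‖ₑ ^ 2 else 0 :=
      fun n => (hk n).comp (measurable_prodMk_left (x := y))
    rw [lintegral_tsum fun n => ((hky n).const_mul (w n)).aemeasurable]
    refine tsum_congr fun n => ?_
    rw [localOscillation, lintegral_const_mul _ (hky n)]
  calc _ = ∫⁻ y in Icc (-π) π, ∑' n, w n * localOscillation f (3 * cellLength n) y := by
        rw [lintegral_tsum fun n =>
          ((measurable_localOscillation hf _).const_mul (w n)).aemeasurable]
        refine tsum_congr fun n => ?_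
        rw [lintegral_const_mul _ (measurable_localOscillation hf _)]
    _ ≤ ∫⁻ y in Icc (-π) π, ENNReal.ofReal 18 * ∫⁻ z in Icc (-π) π,
          ‖f y - f z‖ₑ ^ 2 / ENNReal.ofReal (|y - z| ^ (1 + α)) := by
        refine lintegral_mono fun y => ?_
        rw [hin, ← lintegral_const_mul' _ _ ENNReal.ofReal_ne_top]
        exact lintegral_mono (hpt y)
    _ = _ := lintegral_const_mul' _ _ ENNReal.ofReal_ne_top

/-- Take the sum of the three summable terms `n² b_n`, `e_n` and `1 / n²`: their product is `b_n
e_n`, and each is at most `a_n`. The index `0` is excluded because `1 / n²` is `0` there. -/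
theorem exists_summable_threshold {b e : ℕ → ℝ} (hb : ∀ n, 1 ≤ n → 0 ≤ b n) (he : ∀ n, 0 ≤ e n)
    (hbs : Summable fun n : ℕ => (n : ℝ) ^ 2 * b n) (hes : Summable e) :
    ∃ a : ℕ → ℝ, (∀ n, 1 ≤ n → 0 < a n) ∧ Summable a ∧ ∀ n, 1 ≤ n → b n * e n ≤ a n ^ 3 := by
  refine ⟨fun n => (n : ℝ) ^ 2 * b n + e n + 1 / (n : ℝ) ^ 2, fun n hn => ?_,
    (hbs.add hes).add (Real.summable_one_div_nat_pow.2 one_lt_two), fun n hn => ?_⟩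
  all_goals
    have hn' : (0 : ℝ) < n := by exact_mod_cast hn
    have h1 : 0 ≤ (n : ℝ) ^ 2 * b n := mul_nonneg (by positivity) (hb n hn)
    have h2 := he n
    have h3 : 0 < 1 / (n : ℝ) ^ 2 := by positivity
  · positivity
  · set A := (n : ℝ) ^ 2 * b n
    set D := 1 / (n : ℝ) ^ 2 with hD
    have e1 : b n * e n = A * e n * D := by
      change b n * e n = (n : ℝ) ^ 2 * b n * e n * (1 / (n : ℝ) ^ 2)
      field_simp
    rw [e1]
    calc A * e n * D ≤ (A + e n + D) * (A + e n + D) * (A + e n + D) := by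
          gcongr <;> linarith
      _ = _ := by ring

/-! ### Cell energies and Lebesgue values -/

/-- The oscillation energy of `f` near the cell `j` of the `n`-th grid. -/
noncomputable def cellEnergy (f : ℝ → ℂ) (n : ℕ) (j : ℤ) : ℝ≥0∞ :=
  ∫⁻ y in Icc (-π) π, {y | cellIndex n y ∈ Icc (j - 1) (j + 1)}.indicator
    (localOscillation f (3 * cellLength n)) y

theorem sum_cellEnergy_le {f : ℝ → ℂ} (hf : Measurable f) (n : ℕ) (J : Finset ℤ) :
    ∑ j ∈ J, cellEnergy f n j ≤
      3 * ∫⁻ y in Icc (-π) π, localOscillation f (3 * cellLength n) y := by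
  have hm := measurable_localOscillation hf (3 * cellLength n)
  have hset : ∀ j : ℤ, Measurable ({y | cellIndex n y ∈ Icc (j - 1) (j + 1)}.indicator
      (localOscillation f (3 * cellLength n))) := fun j => hm.indicator
    (measurable_cellIndex n (DiscreteMeasurableSpace.forall_measurableSet (Icc (j - 1) (j + 1))))
  unfold cellEnergy
  rw [← lintegral_finsetSum _ fun j _ => hset j, ← lintegral_const_mul _ hm]
  refine lintegral_mono fun y => ?_
  simp only [indicator_apply, mem_ofPred_eq]
  rw [← Finset.sum_filter, Finset.sum_const, nsmul_eq_mul]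
  gcongr
  have hsub : J.filter (fun j => cellIndex n y ∈ Icc (j - 1) (j + 1)) ⊆
      Finset.Icc (cellIndex n y - 1) (cellIndex n y + 1) := by
    intro j hj
    have := (Finset.mem_filter.1 hj).2
    rw [Finset.mem_Icc]
    constructor <;> linarith [this.1, this.2]
  have := Finset.card_le_card hsub
  rw [Int.card_Icc] at this
  have h3 : (J.filter (fun j => cellIndex n y ∈ Icc (j - 1) (j + 1))).card ≤ 3 := by omega
  exact_mod_cast h3

/-- The ball of radius `s_n` about a point of a cell meets only that cell and its two neighbours,
and two of its points are within `2 s_n ≤ 3 s_n`. -/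
theorem lintegral_sq_ball_le_cellEnergy {f : ℝ → ℂ} {x : ℝ} {n : ℕ}
    (hsub : Icc (x - cellLength n) (x + cellLength n) ⊆ Icc (-π) π) :
    ∫⁻ y in Icc (x - cellLength n) (x + cellLength n),
      ∫⁻ z in Icc (x - cellLength n) (x + cellLength n), ‖f y - f z‖ₑ ^ 2 ≤
      cellEnergy f n (cellIndex n x) := by
  set s := cellLength n with hs
  have hs0 : 0 < s := cellLength_pos n
  refine le_trans ?_ (lintegral_mono_set hsub)
  refine setLIntegral_mono' measurableSet_Icc fun y hy => ?_
  have hmem : y ∈ {y | cellIndex n y ∈ Icc (cellIndex n x - 1) (cellIndex n x + 1)} := by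
    have h1 := (cellIndex_eq_iff (n := n) (x := x)).1 rfl
    have h2 := (cellIndex_eq_iff (n := n) (x := y)).1 rfl
    rw [← hs] at h1 h2
    constructor
    · have : ((cellIndex n x : ℤ) : ℝ) < cellIndex n y + 2 := by
        by_contra hc
        nlinarith [hy.1]
      have : cellIndex n x < cellIndex n y + 2 := by exact_mod_cast this
      omega
    · have : ((cellIndex n y : ℤ) : ℝ) < cellIndex n x + 2 := by
        by_contra hc
        nlinarith [hy.2]
      have : cellIndex n y < cellIndex n x + 2 := by exact_mod_cast this
      omega
  rw [indicator_of_mem hmem, localOscillation]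
  refine le_trans ?_ (lintegral_mono_set hsub)
  refine setLIntegral_mono' measurableSet_Icc fun z hz => ?_
  rw [if_pos]
  rw [abs_le]
  constructor <;> linarith [hy.1, hy.2, hz.1, hz.2]

/-- By `u ≤ u² / (2a) + a / 2`, the double integral of `|f y - f z|` is at most `(5/2) s² a`.
Averaging over `y` yields some value `f y` that serves as the constant. -/
theorem exists_lintegral_sub_const_le {f : ℝ → ℂ} (hf : Measurable f) {x s a : ℝ} (hs : 0 < s)
    (ha : 0 < a)
    (h : ∫⁻ y in Icc (x - s) (x + s), ∫⁻ z in Icc (x - s) (x + s), ‖f y - f z‖ₑ ^ 2 ≤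
      ENNReal.ofReal ((s * a) ^ 2)) :
    ∃ c : ℂ, ∫⁻ y in Icc (x - s) (x + s), ‖f y - c‖ₑ ≤ ENNReal.ofReal (2 * s * a) := by
  set B := Icc (x - s) (x + s)
  have hvol : volume B = ENNReal.ofReal (2 * s) := by
    rw [Real.volume_Icc]; congr 1; ring
  have hpt : ∀ u : ℂ, ‖u‖ₑ ≤ ENNReal.ofReal (1 / (2 * a)) * ‖u‖ₑ ^ 2 + ENNReal.ofReal (a / 2) := by
    intro u
    rw [← ofReal_norm u, ← ENNReal.ofReal_pow (norm_nonneg u),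
      ← ENNReal.ofReal_mul (by positivity), ← ENNReal.ofReal_add (by positivity) (by positivity)]
    refine ENNReal.ofReal_le_ofReal ?_
    have : 1 / (2 * a) * ‖u‖ ^ 2 + a / 2 - ‖u‖ = (‖u‖ - a) ^ 2 / (2 * a) := by
      field_simp; ring
    have : 0 ≤ (‖u‖ - a) ^ 2 / (2 * a) := by positivity
    linarith
  have htot : ∫⁻ y in B, ∫⁻ z in B, ‖f z - f y‖ₑ ≤ ENNReal.ofReal (5 / 2 * s ^ 2 * a) := by
    calc ∫⁻ y in B, ∫⁻ z in B, ‖f z - f y‖ₑ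
        ≤ ∫⁻ y in B, (ENNReal.ofReal (1 / (2 * a)) * ∫⁻ z in B, ‖f y - f z‖ₑ ^ 2) +
            ENNReal.ofReal (a / 2) * volume B := by
          refine lintegral_mono fun y => ?_
          rw [← lintegral_const_mul' _ _ ENNReal.ofReal_ne_top, ← setLIntegral_const,
            ← lintegral_add_right _ measurable_const]
          refine lintegral_mono fun z => ?_
          rw [enorm_sub_rev]
          exact hpt _
      _ = ENNReal.ofReal (1 / (2 * a)) * (∫⁻ y in B, ∫⁻ z in B, ‖f y - f z‖ₑ ^ 2) +
            ENNReal.ofReal (a / 2) * volume B * volume B := by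
          rw [lintegral_add_right _ measurable_const, setLIntegral_const,
            lintegral_const_mul' _ _ ENNReal.ofReal_ne_top]
      _ ≤ ENNReal.ofReal (1 / (2 * a)) * ENNReal.ofReal ((s * a) ^ 2) +
            ENNReal.ofReal (a / 2) * volume B * volume B := by gcongr
      _ = _ := by
          rw [hvol, ← ENNReal.ofReal_mul (by positivity), ← ENNReal.ofReal_mul (by positivity),
            ← ENNReal.ofReal_mul (by positivity),
            ← ENNReal.ofReal_add (by positivity) (by positivity)]
          congr 1
          field_simp
          ring
  have hmeas : Measurable fun y => ∫⁻ z in B, ‖f z - f y‖ₑ := by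
    refine Measurable.lintegral_prod_right' (f := fun p : ℝ × ℝ => ‖f p.2 - f p.1‖ₑ) ?_
    exact ((hf.comp measurable_snd).sub (hf.comp measurable_fst)).enorm
  obtain ⟨y, -, hy⟩ := exists_le_setLAverage (μ := volume) (s := B) (by rw [hvol]; simp [hs])
    (by rw [hvol]; exact ENNReal.ofReal_ne_top) hmeas.aemeasurable
  refine ⟨f y, hy.trans ?_⟩
  rw [setLAverage_eq]
  refine (ENNReal.div_le_div_right htot _).trans ?_
  rw [hvol, ← ENNReal.ofReal_div_of_pos (by positivity)]
  refine ENNReal.ofReal_le_ofReal ?_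
  rw [div_le_iff₀ (by positivity)]
  nlinarith [mul_pos (mul_pos hs hs) ha]

/-- Comparing consecutive constants on the smaller ball gives `|c_n - c_{n+1}| ≤ a_{n+1} + 2 a_n`.
So they converge to some `L` with `|c_n - L| ≤ 3 T`, where `T` is the tail of `a` from `n`, and `2 s
a_n + 2 s * 3 T ≤ 8 s T`. -/
theorem exists_lebesgue_value {f : ℝ → ℂ} (hf : Measurable f) {x : ℝ} {N : ℕ} {a : ℕ → ℝ}
    (ha : ∀ n, N ≤ n → 0 < a n) (has : Summable a)
    (hc : ∀ n, N ≤ n → ∃ c : ℂ, ∫⁻ y in Icc (x - cellLength n) (x + cellLength n), ‖f y - c‖ₑ ≤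
      ENNReal.ofReal (2 * cellLength n * a n)) :
    ∃ L : ℂ, ∀ n, N ≤ n → ∫⁻ y in Icc (x - cellLength n) (x + cellLength n), ‖f y - L‖ₑ ≤
      ENNReal.ofReal (8 * cellLength n * ∑' m, a (m + n)) := by
  have hvol : ∀ n, volume (Icc (x - cellLength n) (x + cellLength n)) =
      ENNReal.ofReal (2 * cellLength n) := by
    intro n
    rw [Real.volume_Icc]; congr 1; ring
  choose! c hc using hc
  have hdist : ∀ n, N ≤ n → dist (c n) (c (n + 1)) ≤ a (n + 1) + 2 * a n := by
    intro n hn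
    have hs := cellLength_pos (n + 1)
    have hs2 := cellLength_succ n
    have h1 : ∫⁻ y in Icc (x - cellLength (n + 1)) (x + cellLength (n + 1)), ‖c n - c (n + 1)‖ₑ ≤
        ENNReal.ofReal (2 * cellLength n * a n) +
          ENNReal.ofReal (2 * cellLength (n + 1) * a (n + 1)) := by
      calc _ ≤ ∫⁻ y in Icc (x - cellLength (n + 1)) (x + cellLength (n + 1)),
            ‖f y - c n‖ₑ + ‖f y - c (n + 1)‖ₑ := by
            refine lintegral_mono fun y => ?_
            rw [show c n - c (n + 1) = (f y - c (n + 1)) + -(f y - c n) by ring, add_comm,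
              ← enorm_neg (f y - c n)]
            exact enorm_add_le _ _
        _ = (∫⁻ y in Icc (x - cellLength (n + 1)) (x + cellLength (n + 1)), ‖f y - c n‖ₑ) +
            ∫⁻ y in Icc (x - cellLength (n + 1)) (x + cellLength (n + 1)), ‖f y - c (n + 1)‖ₑ :=
            lintegral_add_left (hf.sub_const _).enorm _
        _ ≤ _ := by
            refine add_le_add ?_ (hc (n + 1) (by omega))
            refine (lintegral_mono_set (Icc_subset_Icc ?_ ?_)).trans (hc n hn) <;> linarith
    have p0 := ha n hn
    have p1 := ha (n + 1) (by omega)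
    have q0 := cellLength_pos n
    rw [setLIntegral_const, hvol, ← ofReal_norm, ← ENNReal.ofReal_mul (norm_nonneg _),
      ← ENNReal.ofReal_add (by positivity) (by positivity),
      ENNReal.ofReal_le_ofReal_iff (by positivity), hs2] at h1
    rw [dist_eq_norm]
    have h2 : ‖c n - c (n + 1)‖ * (2 * cellLength (n + 1)) ≤
        (a (n + 1) + 2 * a n) * (2 * cellLength (n + 1)) := by linarith
    exact le_of_mul_le_mul_right h2 (by positivity)
  have hshift : ∀ n, Summable fun m => a (m + n) := fun n => (summable_nat_add_iff n).2 has
  set d : ℕ → ℝ := fun k => a (k + (N + 1)) + 2 * a (k + N) with hd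
  have hds : Summable d := (hshift (N + 1)).add ((hshift N).mul_left 2)
  have hdk : ∀ k, dist (c (k + N)) (c (k + 1 + N)) ≤ d k := by
    intro k
    have := hdist (k + N) (by omega)
    rwa [show k + N + 1 = k + 1 + N by ring, show a (k + 1 + N) = a (k + (N + 1)) by ring_nf] at this
  obtain ⟨L, hL⟩ := cauchySeq_tendsto_of_complete (cauchySeq_of_dist_le_of_summable d hdk hds)
  refine ⟨L, fun n hn => ?_⟩
  obtain ⟨k, rfl⟩ : ∃ k, n = k + N := ⟨n - N, by omega⟩
  set T := ∑' m, a (m + (k + N)) with hT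
  have hT1 : a (k + N) + ∑' m, a (m + (k + N + 1)) = T := by
    have := (hshift (k + N)).sum_add_tsum_nat_add 1
    simp only [Finset.range_one, Finset.sum_singleton, zero_add] at this
    rw [hT, ← this]
    congr 1
    refine tsum_congr fun m => ?_
    congr 1
    ring
  have hnn : 0 ≤ ∑' m, a (m + (k + N + 1)) := tsum_nonneg fun m => (ha _ (by omega)).le
  have hak : 0 < a (k + N) := ha _ (by omega)
  have hdL : dist (c (k + N)) L ≤ 3 * T := by
    refine (dist_le_tsum_of_dist_le_of_tendsto d hdk hds hL k).trans ?_
    have e : ∀ m, d (k + m) = a (m + (k + N + 1)) + 2 * a (m + (k + N)) := by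
      intro m
      rw [hd]
      simp only
      congr 2
      · ring
      · congr 1; ring
    simp only [e]
    rw [(hshift (k + N + 1)).tsum_add ((hshift (k + N)).mul_left 2), tsum_mul_left, ← hT]
    linarith
  have hs := cellLength_pos (k + N)
  have hT0 : 0 ≤ T := by linarith
  calc ∫⁻ y in Icc (x - cellLength (k + N)) (x + cellLength (k + N)), ‖f y - L‖ₑ
      ≤ ∫⁻ y in Icc (x - cellLength (k + N)) (x + cellLength (k + N)),
          ‖f y - c (k + N)‖ₑ + ‖c (k + N) - L‖ₑ := by
        refine lintegral_mono fun y => ?_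
        rw [show f y - L = (f y - c (k + N)) + (c (k + N) - L) by ring]
        exact enorm_add_le _ _
    _ = (∫⁻ y in Icc (x - cellLength (k + N)) (x + cellLength (k + N)), ‖f y - c (k + N)‖ₑ) +
          ENNReal.ofReal (dist (c (k + N)) L * (2 * cellLength (k + N))) := by
        rw [lintegral_add_right _ measurable_const, setLIntegral_const, hvol, ← ofReal_norm,
          ← dist_eq_norm, ← ENNReal.ofReal_mul dist_nonneg]
    _ ≤ ENNReal.ofReal (2 * cellLength (k + N) * a (k + N)) +
          ENNReal.ofReal (3 * T * (2 * cellLength (k + N))) := by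
        gcongr
        exact hc _ (by omega)
    _ ≤ _ := by
        rw [← ENNReal.ofReal_add (by positivity) (by positivity)]
        refine ENNReal.ofReal_le_ofReal ?_
        nlinarith

theorem lintegral_cell_le_of_good {f : ℝ → ℂ} (hf : Measurable f)
    (hfi : IntegrableOn f (Icc (-π) π)) {x : ℝ} {N : ℕ} {a : ℕ → ℝ}
    (ha : ∀ n, N ≤ n → 0 < a n) (has : Summable a)
    (hsub : Icc (x - cellLength N) (x + cellLength N) ⊆ Icc (-π) π)
    (hgood : ∀ n, N ≤ n →
      cellEnergy f n (cellIndex n x) ≤ ENNReal.ofReal ((cellLength n * a n) ^ 2))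
    (habel : Tendsto (fun r : ℝ => abelMean f r x) (𝓝[<] 1) (𝓝 0)) :
    ∫⁻ y in Icc (x - cellLength N) (x + cellLength N), ‖f y‖ₑ ≤
      ENNReal.ofReal (8 * cellLength N * ∑' m, a (m + N)) := by
  have hmono : ∀ n, N ≤ n → cellLength n ≤ cellLength N := by
    intro n hn
    unfold cellLength
    gcongr
    norm_num
  obtain ⟨L, hL⟩ := exists_lebesgue_value hf ha has fun n hn =>
    exists_lintegral_sub_const_le hf (cellLength_pos n) (ha n hn)
      ((lintegral_sq_ball_le_cellEnergy ((Icc_subset_Icc (by linarith [hmono n hn])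
        (by linarith [hmono n hn])).trans hsub)).trans (hgood n hn))
  have hsN := cellLength_pos N
  have hx : x ∈ Ioo (-π) π := by
    have h1 := hsub (left_mem_Icc.2 (by linarith))
    have h2 := hsub (right_mem_Icc.2 (by linarith))
    exact ⟨by linarith [h1.1], by linarith [h2.2]⟩
  have hlim : Tendsto (fun r : ℝ => abelMean f r x) (𝓝[<] 1) (𝓝 L) := by
    refine tendsto_abelMean_of_lebesguePoint hf hfi hx fun ε hε => ?_
    have h0 : ∀ᶠ n in atTop, ∑' m, a (m + n) < ε / 16 :=
      (tendsto_sum_nat_add a).eventually_lt_const (by positivity)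
    obtain ⟨n₀, hn₀⟩ := eventually_atTop.1 h0
    refine ⟨cellLength (max n₀ N), cellLength_pos _, fun s hs hs' => ?_⟩
    -- The radius `s` is placed between consecutive cell lengths; the ratio `2` between them turns
    -- the constant `8` into `16`.
    have hex : ∃ k, cellLength k < s := by
      obtain ⟨k, hk⟩ := pow_unbounded_of_one_lt (2 * π / s) (one_lt_two)
      refine ⟨k, ?_⟩
      rw [cellLength, div_lt_iff₀ (by positivity)]
      rw [div_lt_iff₀ hs] at hk
      linarith
    classical
    have hk := Nat.find_spec hex
    have hmin := fun m => Nat.find_min hex (m := m)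
    set k := Nat.find hex
    have hkm : max n₀ N < k := by
      by_contra hcon
      have : cellLength (max n₀ N) ≤ cellLength k := by
        unfold cellLength
        gcongr
        · norm_num
        · omega
      linarith
    obtain ⟨n, hkn⟩ : ∃ n, k = n + 1 := ⟨k - 1, by omega⟩
    rw [hkn] at hk
    have hsn : s ≤ cellLength n := not_lt.1 (hmin n (by omega))
    have hnN : N ≤ n := by omega
    have hnn : n₀ ≤ n := by omega
    refine (lintegral_mono_set (Icc_subset_Icc (by linarith) (by linarith))).trans
      ((hL n hnN).trans (ENNReal.ofReal_le_ofReal ?_))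
    have hT := hn₀ n hnn
    have hT0 : 0 ≤ ∑' m, a (m + n) := tsum_nonneg fun m => (ha _ (by omega)).le
    rw [cellLength_succ n]
    nlinarith [mul_le_mul_of_nonneg_right hk.le hT0]
  have hL0 : L = 0 := tendsto_nhds_unique hlim habel
  have := hL N le_rfl
  simpa [hL0] using this

/-! ### Counting bad cells and covering by them -/

theorem cellIndex_eq_ediv {N n : ℕ} (hn : N ≤ n) (x : ℝ) :
    cellIndex N x = cellIndex n x / 2 ^ (n - N) := by
  obtain ⟨k, rfl⟩ := Nat.exists_eq_add_of_le hn
  have hN := cellLength_pos N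
  have e : cellLength N = 2 ^ k * cellLength (N + k) := by
    rw [cellLength, cellLength, pow_add]; field_simp
  have e2 : (x + π) / cellLength N = (x + π) / cellLength (N + k) / ((2 ^ k : ℕ) : ℝ) := by
    rw [e]; push_cast; rw [div_div, mul_comm]
  rw [add_tsub_cancel_left, cellIndex, cellIndex, e2, Int.floor_div_natCast]
  push_cast
  rfl

theorem volume_cell_le (n : ℕ) (j : ℤ) :
    volume {x | cellIndex n x = j} ≤ ENNReal.ofReal (cellLength n) := by
  have hsub : {x | cellIndex n x = j} ⊆
      Ico (-π + j * cellLength n) (-π + j * cellLength n + cellLength n) :=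
    fun x hx => cellIndex_eq_iff.1 hx
  refine (measure_mono hsub).trans (le_of_eq ?_)
  rw [Real.volume_Ico]
  congr 1
  ring

/-- Chebyshev's inequality with overlap `3` gives `card * a² ≤ 3 e s^(α-1)`. Multiplying by `H` and
using the cubic threshold leaves `3 a`. -/
theorem card_mul_gauge_le {f : ℝ → ℂ} (hf : Measurable f) {n : ℕ} {α e H a : ℝ}
    (he : 0 ≤ e) (hH : 0 ≤ H) (ha : 0 < a)
    (hosc : ∫⁻ y in Icc (-π) π, localOscillation f (3 * cellLength n) y ≤
      ENNReal.ofReal (e * cellLength n ^ (1 + α)))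
    (hle : cellLength n ^ (α - 1) * H * e ≤ a ^ 3) {J : Finset ℤ}
    (hJ : ∀ j ∈ J, ENNReal.ofReal ((cellLength n * a) ^ 2) < cellEnergy f n j) :
    J.card * H ≤ 3 * a := by
  have hs := cellLength_pos n
  set s := cellLength n
  have h1 : (J.card : ℝ≥0∞) * ENNReal.ofReal ((s * a) ^ 2) ≤
      3 * ENNReal.ofReal (e * s ^ (1 + α)) := by
    refine le_trans ?_ ((sum_cellEnergy_le hf n J).trans (by gcongr))
    rw [← nsmul_eq_mul]
    exact Finset.card_nsmul_le_sum _ _ _ fun j hj => (hJ j hj).le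
  have hp : 0 < s ^ (1 + α) := Real.rpow_pos_of_pos hs _
  have h3 : (3 : ℝ≥0∞) = ENNReal.ofReal 3 := by simp
  rw [h3, ← ENNReal.ofReal_natCast, ← ENNReal.ofReal_mul (by positivity),
    ← ENNReal.ofReal_mul (by positivity), ENNReal.ofReal_le_ofReal_iff (by positivity)] at h1
  have hq : s ^ (1 + α) = s ^ (α - 1) * s ^ 2 := by
    rw [← Real.rpow_natCast s 2, ← Real.rpow_add hs]
    congr 1
    push_cast
    ring
  rw [hq] at h1
  have h2 : (J.card : ℝ) * a ^ 2 ≤ 3 * (e * s ^ (α - 1)) := by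
    refine le_of_mul_le_mul_right ?_ (pow_pos hs 2)
    linarith
  refine le_of_mul_le_mul_right ?_ (pow_pos ha 2)
  calc J.card * H * a ^ 2 = J.card * a ^ 2 * H := by ring
    _ ≤ 3 * (e * s ^ (α - 1)) * H := mul_le_mul_of_nonneg_right h2 hH
    _ = 3 * (s ^ (α - 1) * H * e) := by ring
    _ ≤ 3 * a ^ 3 := by gcongr
    _ = 3 * a * a ^ 2 := by ring

theorem tsum_bad_cells_le {N : ℕ} {H a : ℕ → ℝ}
    (ha : ∀ n, N ≤ n → 0 < a n) (has : Summable a) {bad : ℕ → ℤ → Prop}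
    (hcard : ∀ n, N ≤ n → ∀ J : Finset ℤ, (∀ j ∈ J, bad n j) → J.card * H n ≤ 3 * a n) :
    ∑' p : ℕ × ℤ, {p : ℕ × ℤ | N ≤ p.1 ∧ bad p.1 p.2}.indicator
      (fun p => ENNReal.ofReal (H p.1)) p ≤ ENNReal.ofReal (3 * ∑' m, a (m + N)) := by
  classical
  have hrow : ∀ n, ∑' j : ℤ, {p : ℕ × ℤ | N ≤ p.1 ∧ bad p.1 p.2}.indicator
      (fun p => ENNReal.ofReal (H p.1)) (n, j) ≤ if N ≤ n then ENNReal.ofReal (3 * a n) else 0 := by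
    intro n
    split_ifs with hn
    · rw [ENNReal.tsum_eq_iSup_sum]
      refine iSup_le fun J => ?_
      simp only [indicator_apply, mem_ofPred_eq, hn, true_and]
      rw [← Finset.sum_filter, Finset.sum_const, nsmul_eq_mul, ← ENNReal.ofReal_natCast,
        ← ENNReal.ofReal_mul (by positivity)]
      exact ENNReal.ofReal_le_ofReal (hcard n hn _ fun j hj => (Finset.mem_filter.1 hj).2)
    · simp [hn]
  rw [ENNReal.tsum_prod']
  refine (ENNReal.tsum_le_tsum hrow).trans ?_
  rw [← Summable.sum_add_tsum_nat_add' (k := N)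
    (f := fun n => if N ≤ n then ENNReal.ofReal (3 * a n) else 0) ENNReal.summable]
  have hz : ∑ n ∈ Finset.range N, (if N ≤ n then ENNReal.ofReal (3 * a n) else 0) = 0 :=
    Finset.sum_eq_zero fun n hn => if_neg (not_le.2 (Finset.mem_range.1 hn))
  have hpos : ∀ m, 0 ≤ 3 * a (m + N) := fun m => by
    have := ha (m + N) (by omega)
    positivity
  rw [hz, zero_add, ← tsum_mul_left, ENNReal.ofReal_tsum_of_nonneg hpos
    (((summable_nat_add_iff N).2 has).mul_left 3)]
  refine ENNReal.tsum_le_tsum fun m => ?_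
  rw [if_pos (by omega)]

/-- A cell with a good point of `E` contributes at most `8 s T`. On the others nothing is known
about `f`, so the truncation at `1` charges their length, and their number is bounded through the
content of `E`. -/
theorem lintegral_min_one_le {f : ℝ → ℂ} {h : ℝ → ℝ}
    (h_zero : h 0 = 0) {E : Set ℝ} (hE_sub : E ⊆ Icc (-π) π) {c : ℝ} (hc : 0 < c)
    (hE_pos : ENNReal.ofReal c ≤ hausdorffContent h (Circle.exp '' E)) {N : ℕ} (hN : 4 ≤ N)
    (hE_inv : ∀ x ∈ E, ∀ k : ℤ, ∃ m : ℤ, x + 2 * π * k / 2 ^ N + 2 * π * m ∈ E)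
    {bad : ℕ → ℤ → Prop} {T : ℝ} (hT : 0 ≤ T)
    (hbad : ∑' p : ℕ × ℤ, {p : ℕ × ℤ | N ≤ p.1 ∧ bad p.1 p.2}.indicator
      (fun p => ENNReal.ofReal (h (8 / 2 ^ p.1))) p ≤ ENNReal.ofReal (3 * T))
    (hgood : ∀ x ∈ E, Icc (x - cellLength N) (x + cellLength N) ⊆ Icc (-π) π →
      (∀ n, N ≤ n → ¬ bad n (cellIndex n x)) →
      ∫⁻ y in Icc (x - cellLength N) (x + cellLength N), ‖f y‖ₑ ≤
        ENNReal.ofReal (8 * cellLength N * T)) :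
    ∫⁻ y in Icc (-π) π, min ‖f y‖ₑ 1 ≤
      ENNReal.ofReal (32 * π * T + 6 * π * T / c + 3 * cellLength N) := by
  classical
  set s := cellLength N with hs
  have hs0 : 0 < s := cellLength_pos N
  have hs2 : 2 ^ N * s = 2 * π := two_pow_mul_cellLength N
  set good : ℤ → Prop := fun j => ∃ x ∈ E, cellIndex N x = j ∧
    ∀ n, N ≤ n → ¬ bad n (cellIndex n x) with hgooddef
  set B : Finset ℤ := (Finset.Icc 1 (2 ^ N - 2)).filter fun j => ¬ good j with hB
  set S : ℤ → Set (ℕ × ℤ) := fun j =>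
    {p | (N ≤ p.1 ∧ bad p.1 p.2) ∧ p.2 / 2 ^ (p.1 - N) = j} with hS
  set g : ℕ × ℤ → ℝ≥0∞ := fun p => ENNReal.ofReal (h (8 / 2 ^ p.1)) with hg
  have hcell : ∀ j ∈ B, ENNReal.ofReal c ≤ 2 ^ N * ∑' p, (S j).indicator g p := by
    intro j hj
    obtain ⟨hj1, hj2⟩ := Finset.mem_filter.1 hj
    rw [Finset.mem_Icc] at hj1
    rw [← tsum_subtype]
    refine hE_pos.trans (hausdorffContent_le_of_cell_cover h_zero hE_sub hE_inv (j := j)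
      (ι := S j) (a := fun p => -π + p.1.2 * cellLength p.1.1) (l := fun p => 8 / 2 ^ p.1.1)
      hj1.1 (by linarith [hj1.2]) ?_ ?_)
    · rintro ⟨p, hp⟩
      refine ⟨by positivity, ?_⟩
      -- From level `4` on, the arc length `8 / 2 ^ n`, which dominates `2π / 2 ^ n`, is admissible.
      have h4 : 4 ≤ p.1 := hN.trans hp.1.1
      rw [div_le_one (by positivity)]
      calc (8 : ℝ) ≤ 2 ^ 4 := by norm_num
        _ ≤ 2 ^ p.1 := pow_le_pow_right₀ (by norm_num) h4
    · intro x hx hxj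
      have : ¬ ∀ n, N ≤ n → ¬ bad n (cellIndex n x) := fun hcon => hj2 ⟨x, hx, hxj, hcon⟩
      push Not at this
      obtain ⟨n, hn, hbn⟩ := this
      refine ⟨⟨(n, cellIndex n x), ⟨hn, hbn⟩, ?_⟩, ?_⟩
      · rw [← hxj, cellIndex_eq_ediv hn]
      · have hi := (cellIndex_eq_iff (n := n) (x := x)).1 rfl
        have hl : cellLength n ≤ 8 / 2 ^ n := by
          unfold cellLength
          gcongr
          linarith [pi_le_four]
        exact ⟨hi.1, by simp only; linarith [hi.2]⟩
  have hBc : (B.card : ℝ) * c ≤ 2 ^ N * (3 * T) := by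
    have h1 : (B.card : ℝ≥0∞) * ENNReal.ofReal c ≤ 2 ^ N * ENNReal.ofReal (3 * T) := by
      calc (B.card : ℝ≥0∞) * ENNReal.ofReal c
          ≤ ∑ j ∈ B, 2 ^ N * ∑' p, (S j).indicator g p := by
            rw [← nsmul_eq_mul]
            exact Finset.card_nsmul_le_sum _ _ _ hcell
        _ = 2 ^ N * ∑' p, ∑ j ∈ B, (S j).indicator g p := by
            rw [← Finset.mul_sum, Summable.tsum_finsetSum fun _ _ => ENNReal.summable]
        _ ≤ 2 ^ N * ENNReal.ofReal (3 * T) := by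
            gcongr
            -- Each bad cell lies in exactly one cell of level `N`, so it is counted at most once.
            refine (ENNReal.tsum_le_tsum fun p => ?_).trans hbad
            by_cases hp : N ≤ p.1 ∧ bad p.1 p.2
            · rw [indicator_of_mem (show p ∈ {p : ℕ × ℤ | N ≤ p.1 ∧ bad p.1 p.2} from hp)]
              have : ∀ j, (S j).indicator g p = if p.2 / 2 ^ (p.1 - N) = j then g p else 0 := by
                intro j
                simp [hS, indicator_apply, hp]
              simp only [this, Finset.sum_ite_eq]
              split_ifs
              · exact le_rfl
              · exact zero_le
            · have : ∀ j, (S j).indicator g p = 0 := fun j =>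
                indicator_of_notMem (fun hcon => hp hcon.1) _
              simp [this]
    have h2 : ((2 : ℝ≥0∞) ^ N) = ENNReal.ofReal (2 ^ N) := by
      rw [ENNReal.ofReal_pow (by norm_num)]; simp
    rwa [h2, ← ENNReal.ofReal_natCast, ← ENNReal.ofReal_mul (by positivity),
      ← ENNReal.ofReal_mul (by positivity), ENNReal.ofReal_le_ofReal_iff (by positivity)] at h1
  -- In the two end cells the ball of radius `s` may leave `[-π, π]`; index `2 ^ N` is there for the
  -- point `π`. These three produce the term `3 * cellLength N`.
  set D : Finset ℤ := B ∪ {0, 2 ^ N - 1, 2 ^ N} with hD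
  have hDc : (D.card : ℝ) ≤ B.card + 3 := by
    have h1 : ({0, 2 ^ N - 1, 2 ^ N} : Finset ℤ).card ≤ 3 := Finset.card_le_three
    have h2 := Finset.card_union_le B {0, 2 ^ N - 1, 2 ^ N}
    have h3 : D.card ≤ B.card + 3 := h2.trans (by omega)
    exact_mod_cast h3
  have hone : ∀ j ∈ Finset.Icc (0 : ℤ) (2 ^ N),
      ∫⁻ y in {x | cellIndex N x = j}, min ‖f y‖ₑ 1 ≤
      ENNReal.ofReal (8 * s * T) + if j ∈ D then ENNReal.ofReal s else 0 := by
    intro j hj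
    rw [Finset.mem_Icc] at hj
    by_cases hjD : j ∈ D
    · rw [if_pos hjD]
      refine le_add_left ?_
      calc _ ≤ ∫⁻ y in {x | cellIndex N x = j}, 1 := lintegral_mono fun y => min_le_right _ _
        _ ≤ _ := by rw [setLIntegral_one]; exact volume_cell_le N j
    · rw [if_neg hjD, add_zero]
      simp only [hD, Finset.mem_union, Finset.mem_insert, Finset.mem_singleton, not_or] at hjD
      obtain ⟨hjB, hj0, hj1, hj2⟩ := hjD
      have hjr : 1 ≤ j ∧ j ≤ 2 ^ N - 2 := by omega
      have hgj : good j := by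
        by_contra hcon
        exact hjB (Finset.mem_filter.2 ⟨Finset.mem_Icc.2 hjr, hcon⟩)
      obtain ⟨x, hxE, hxj, hxg⟩ := hgj
      have hx := cellIndex_eq_iff.1 hxj
      rw [← hs] at hx
      have hj1' : (1 : ℝ) ≤ j := by exact_mod_cast hjr.1
      have hj2' : (j : ℝ) + 2 ≤ 2 ^ N := by
        have : j + 2 ≤ 2 ^ N := by linarith [hjr.2]
        exact_mod_cast this
      have hsub : Icc (x - s) (x + s) ⊆ Icc (-π) π := by
        refine Icc_subset_Icc ?_ ?_
        · nlinarith [hx.1]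
        · nlinarith [hx.2, mul_le_mul_of_nonneg_right hj2' hs0.le]
      refine le_trans ?_ (hgood x hxE hsub hxg)
      refine (lintegral_mono fun y => min_le_left _ _).trans (lintegral_mono_set fun y hy => ?_)
      have hy' := cellIndex_eq_iff.1 hy
      rw [← hs] at hy'
      constructor <;> linarith [hx.1, hx.2, hy'.1, hy'.2]
  have hcover : Icc (-π) π ⊆ ⋃ j ∈ Finset.Icc (0 : ℤ) (2 ^ N), {x | cellIndex N x = j} := by
    intro x hx
    simp only [mem_iUnion, exists_prop]
    refine ⟨cellIndex N x, Finset.mem_Icc.2 ⟨?_, ?_⟩, rfl⟩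
    · exact Int.floor_nonneg.2 (div_nonneg (by linarith [hx.1]) hs0.le)
    · have : (x + π) / s ≤ 2 ^ N := by
        rw [div_le_iff₀ hs0, hs2]; linarith [hx.2]
      have h2 : ((cellIndex N x : ℤ) : ℝ) ≤ 2 ^ N := (Int.floor_le _).trans this
      exact_mod_cast h2
  have hcard : ((Finset.Icc (0 : ℤ) (2 ^ N)).card : ℝ) = 2 ^ N + 1 := by
    rw [Int.card_Icc]
    have : ((2 ^ N + 1 - 0 : ℤ).toNat : ℤ) = 2 ^ N + 1 := by
      rw [sub_zero, Int.toNat_of_nonneg (by positivity)]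
    exact_mod_cast this
  calc ∫⁻ y in Icc (-π) π, min ‖f y‖ₑ 1
      ≤ ∫⁻ y in ⋃ j ∈ Finset.Icc (0 : ℤ) (2 ^ N), {x | cellIndex N x = j}, min ‖f y‖ₑ 1 :=
        lintegral_mono_set hcover
    _ = ∑ j ∈ Finset.Icc (0 : ℤ) (2 ^ N), ∫⁻ y in {x | cellIndex N x = j}, min ‖f y‖ₑ 1 := by
        refine lintegral_biUnion_finset ?_ (fun j _ => measurable_cellIndex N (.singleton j)) _
        intro i _ j _ hij
        exact disjoint_left.2 fun x hx hx' => hij (hx.symm.trans hx')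
    _ ≤ ∑ j ∈ Finset.Icc (0 : ℤ) (2 ^ N),
          (ENNReal.ofReal (8 * s * T) + if j ∈ D then ENNReal.ofReal s else 0) :=
        Finset.sum_le_sum hone
    _ ≤ ENNReal.ofReal ((2 ^ N + 1) * (8 * s * T)) + ENNReal.ofReal (D.card * s) := by
        rw [Finset.sum_add_distrib, Finset.sum_const, nsmul_eq_mul, ← ENNReal.ofReal_natCast, hcard,
          ← ENNReal.ofReal_mul (by positivity), ← Finset.sum_filter, Finset.sum_const,
          nsmul_eq_mul, ENNReal.ofReal_mul (Nat.cast_nonneg _), ENNReal.ofReal_natCast]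
        gcongr
        intro j hj
        exact (Finset.mem_filter.1 hj).2
    _ ≤ _ := by
        rw [← ENNReal.ofReal_add (by positivity) (by positivity)]
        refine ENNReal.ofReal_le_ofReal ?_
        have hs1 : s ≤ 2 * π := by
          rw [← hs2]
          exact le_mul_of_one_le_left hs0.le (one_le_pow₀ (by norm_num))
        have e1 : (2 ^ N + 1) * (8 * s * T) ≤ 32 * π * T := by
          calc (2 ^ N + 1) * (8 * s * T) = 8 * T * (2 ^ N * s + s) := by ring
            _ ≤ 8 * T * (2 * π + 2 * π) := by rw [hs2]; gcongr
            _ = _ := by ring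
        have e2 : (B.card : ℝ) * s ≤ 6 * π * T / c := by
          rw [le_div_iff₀ hc]
          calc (B.card : ℝ) * s * c = B.card * c * s := by ring
            _ ≤ 2 ^ N * (3 * T) * s := by gcongr
            _ = 3 * T * (2 ^ N * s) := by ring
            _ = _ := by rw [hs2]; ring
        have e3 : (D.card : ℝ) * s ≤ (B.card + 3) * s := by gcongr
        linarith

/-! ### Conclusion -/

theorem ae_eq_zero_of_measurable {α : ℝ} (hα0 : 0 < α) (hα1 : α < 1)
    {h : ℝ → ℝ} (h_mono : MonotoneOn h (Icc 0 1)) (h_zero : h 0 = 0)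
    (h_ge : ∀ x ∈ Ico (0 : ℝ) 1, x ≤ h x)
    (h_int : IntegrableOn
      (fun x : ℝ => h x / x ^ (2 - α) * Real.log (Real.exp 1 / x) ^ 2) (Ioo 0 1))
    {f : ℝ → ℂ} (hf : Measurable f) (hf_energy : fractionalEnergy α f < ∞)
    {E : Set ℝ} (hE_sub : E ⊆ Icc (-π) π)
    (hE_pos : 0 < hausdorffContent h (Circle.exp '' E))
    (hE_inv : ∀ x ∈ E, ∀ (n : ℕ) (k : ℤ), ∃ m : ℤ, x + 2 * π * k / 2 ^ n + 2 * π * m ∈ E)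
    (hE_abel : ∀ x ∈ E, Tendsto (fun r : ℝ => abelMean f r x) (𝓝[<] 1) (𝓝 0)) :
    ∀ᵐ x ∂(volume.restrict (Icc (-π) π)), f x = 0 := by
  obtain ⟨hL2, hen⟩ := ENNReal.add_lt_top.1 hf_energy
  have hfi : IntegrableOn f (Icc (-π) π) := by
    refine ⟨hf.aestronglyMeasurable, ?_⟩
    have hpt : ∀ x, ‖f x‖ₑ ≤ ‖f x‖ₑ ^ 2 + 1 := by
      intro x
      rcases le_total ‖f x‖ₑ 1 with h1 | h1
      · exact le_add_left h1
      · exact le_add_right (le_self_pow₀ h1 two_ne_zero)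
    refine (lintegral_mono hpt).trans_lt ?_
    rw [lintegral_add_right _ measurable_const]
    exact ENNReal.add_lt_top.2 ⟨hL2, by simp⟩
  set G : ℕ → ℝ≥0∞ := fun n =>
    ∫⁻ y in Icc (-π) π, localOscillation f (3 * cellLength n) y with hG
  have hw : ∀ n, 0 < cellLength n ^ (1 + α) := fun n => Real.rpow_pos_of_pos (cellLength_pos n) _
  have htop : ∑' n, ENNReal.ofReal (cellLength n ^ (1 + α))⁻¹ * G n ≠ ∞ :=
    ((tsum_localOscillation_le hα0 hα1 hf).trans_lt
      (ENNReal.mul_lt_top ENNReal.ofReal_lt_top hen)).ne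
  set e : ℕ → ℝ := fun n => (ENNReal.ofReal (cellLength n ^ (1 + α))⁻¹ * G n).toReal with he
  have hes : Summable e := ENNReal.summable_toReal htop
  have he0 : ∀ n, 0 ≤ e n := fun n => ENNReal.toReal_nonneg
  have hGe : ∀ n, G n ≤ ENNReal.ofReal (e n * cellLength n ^ (1 + α)) := by
    intro n
    rw [ENNReal.ofReal_mul (he0 n), he, ENNReal.ofReal_toReal (ENNReal.ne_top_of_tsum_ne_top htop n),
      mul_right_comm, ← ENNReal.ofReal_mul (inv_nonneg.2 (hw n).le), inv_mul_cancel₀ (hw n).ne']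
    simp
  have hH : ∀ n, 4 ≤ n → 0 ≤ h (8 / 2 ^ n) := by
    intro n hn
    refine le_trans (by positivity) (h_ge _ ⟨by positivity, ?_⟩)
    rw [div_lt_one (by positivity)]
    calc (8 : ℝ) < 2 ^ 4 := by norm_num
      _ ≤ 2 ^ n := pow_le_pow_right₀ (by norm_num) hn
  -- Below level `4` the argument `8 / 2 ^ n` is at least `1`, where the sign of `h` is not
  -- controlled by `h_ge`.
  set b : ℕ → ℝ := fun n => if 4 ≤ n then cellLength n ^ (α - 1) * h (8 / 2 ^ n) else 0 with hb
  have hb0 : ∀ n, 1 ≤ n → 0 ≤ b n := by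
    intro n _
    simp only [hb]
    split_ifs with hn
    · exact mul_nonneg (Real.rpow_nonneg (cellLength_pos n).le _) (hH n hn)
    · exact le_rfl
  have hbs : Summable fun n : ℕ => (n : ℝ) ^ 2 * b n := by
    rw [← summable_nat_add_iff 4]
    refine ((summable_nat_add_iff 4).2 (summable_gauge hα0 hα1 h_mono h_ge h_int)).congr fun n => ?_
    simp [hb]
  obtain ⟨a, ha, has, hab⟩ := exists_summable_threshold hb0 he0 hbs hes
  obtain ⟨c, hc0, hc⟩ : ∃ c : ℝ, 0 < c ∧
      ENNReal.ofReal c ≤ hausdorffContent h (Circle.exp '' E) := by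
    obtain ⟨c, hc0, hc⟩ := ENNReal.lt_iff_exists_nnreal_btwn.1 hE_pos
    exact ⟨c, by exact_mod_cast hc0, by rw [ENNReal.ofReal_coe_nnreal]; exact hc.le⟩
  set T : ℕ → ℝ := fun N => ∑' m, a (m + N) with hT
  have hTlim : Tendsto T atTop (𝓝 0) := tendsto_sum_nat_add a
  have hslim : Tendsto cellLength atTop (𝓝 0) :=
    tendsto_const_nhds.div_atTop (tendsto_pow_atTop_atTop_of_one_lt one_lt_two)
  have hbound : ∀ N, 4 ≤ N → ∫⁻ y in Icc (-π) π, min ‖f y‖ₑ 1 ≤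
      ENNReal.ofReal (32 * π * T N + 6 * π * T N / c + 3 * cellLength N) := by
    intro N hN
    have haN : ∀ n, N ≤ n → 0 < a n := fun n hn => ha n (by omega)
    set bad : ℕ → ℤ → Prop := fun n j =>
      ENNReal.ofReal ((cellLength n * a n) ^ 2) < cellEnergy f n j with hbad
    refine lintegral_min_one_le h_zero hE_sub hc0 hc hN (fun x hx => hE_inv x hx N) (bad := bad)
      (tsum_nonneg fun m => (haN _ (by omega)).le)
      (tsum_bad_cells_le (bad := bad) (H := fun n => h (8 / 2 ^ n)) haN has fun n hn J hJ => ?_) ?_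
    · have hab' := hab n (by omega)
      simp only [hb, if_pos (hN.trans hn)] at hab'
      exact card_mul_gauge_le hf (he0 n) (hH n (hN.trans hn)) (haN n hn) (hGe n) hab' hJ
    · intro x hx hsub hgood
      exact lintegral_cell_le_of_good hf hfi haN has hsub (fun n hn => not_lt.1 (hgood n hn))
        (hE_abel x hx)
  have hlim : Tendsto (fun N => ENNReal.ofReal
      (32 * π * T N + 6 * π * T N / c + 3 * cellLength N)) atTop (𝓝 0) := by
    have := ((hTlim.const_mul (32 * π)).add ((hTlim.const_mul (6 * π)).div_const c)).add
      (hslim.const_mul 3)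
    simpa using ENNReal.tendsto_ofReal this
  have hzero : ∫⁻ y in Icc (-π) π, min ‖f y‖ₑ 1 = 0 :=
    le_antisymm (ge_of_tendsto hlim (eventually_atTop.2 ⟨4, hbound⟩)) zero_le
  rw [lintegral_eq_zero_iff (hf.enorm.min measurable_const)] at hzero
  filter_upwards [hzero] with x hx
  have hx' : f x = 0 ∧ ‖f x‖ₑ ≤ 1 := by simpa [min_eq_iff] using hx
  exact hx'.1

theorem theorem6 (α : ℝ) (hα0 : 0 < α) (hα1 : α < 1)
    (h : ℝ → ℝ) (h_mono : MonotoneOn h (Icc 0 1)) (h_zero : h 0 = 0)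
    (h_ge : ∀ x ∈ Ico (0 : ℝ) 1, x ≤ h x)
    (h_int : IntegrableOn
      (fun x : ℝ => h x / x ^ (2 - α) * Real.log (Real.exp 1 / x) ^ 2) (Ioo 0 1))
    (f : ℝ → ℂ) (hf_meas : AEStronglyMeasurable f (volume.restrict (Icc (-π) π)))
    (hf_energy : fractionalEnergy α f < ∞)
    (E : Set ℝ) (hE_sub : E ⊆ Icc (-π) π)
    (hE_pos : 0 < hausdorffContent h (Circle.exp '' E))
    (hE_inv : ∀ x ∈ E, ∀ p : ℕ, p.Prime → ∀ (n : ℕ) (k : ℤ),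
      ∃ m : ℤ, x + 2 * π * k / (p : ℝ) ^ n + 2 * π * m ∈ E)
    (hE_abel : ∀ x ∈ E, Tendsto (fun r : ℝ => abelMean f r x) (𝓝[<] 1) (𝓝 0)) :
    ∀ᵐ x ∂(volume.restrict (Icc (-π) π)), f x = 0 := by

  set μ := volume.restrict (Icc (-π) π) with hμ
  -- Energy and Fourier coefficients ignore null sets, so the Abel means of the Borel version `g`
  -- agree with those of `f` at every point, in particular on `E`, which may itself be null.
  set g := hf_meas.mk f with hg
  have hfg : f =ᵐ[μ] g := hf_meas.ae_eq_mk
  have hgm : Measurable g := hf_meas.stronglyMeasurable_mk.measurable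
  have hcoeff : ∀ k, fourierCoefficient g k = fourierCoefficient f k := by
    intro k
    rw [fourierCoefficient_eq, fourierCoefficient_eq]
    congr 1
    have hle : -π ≤ π := by linarith [pi_pos]
    rw [intervalIntegral.integral_of_le hle, intervalIntegral.integral_of_le hle,
      ← integral_Icc_eq_integral_Ioc, ← integral_Icc_eq_integral_Ioc]
    refine integral_congr_ae ?_
    filter_upwards [hfg] with x hx
    rw [hx]
  have habel : ∀ r x, abelMean g r x = abelMean f r x := by
    intro r x
    simp only [abelMean, hcoeff]
  have henergy : fractionalEnergy α g = fractionalEnergy α f := by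
    unfold fractionalEnergy
    congr 1
    · refine lintegral_congr_ae ?_
      filter_upwards [hfg] with x hx
      rw [hx]
    · refine lintegral_congr_ae ?_
      filter_upwards [hfg] with x hx
      refine lintegral_congr_ae ?_
      filter_upwards [hfg] with y hy
      rw [hx, hy]
  have hg0 := ae_eq_zero_of_measurable hα0 hα1 h_mono h_zero h_ge h_int hgm (by rwa [henergy])
    hE_sub hE_pos (fun x hx n k => by simpa using hE_inv x hx 2 Nat.prime_two n k)
    (fun x hx => by simpa only [habel] using hE_abel x hx)
  filter_upwards [hfg, hg0] with x h1 h2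
  rw [h1, h2]
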